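/- Let $d\in\{1,2,3\}$, $L>0$, $D=[-L,L]^d$, and let $\|\cdot\|$ be the $L^2(D)$ norm, with $\|\boldsymbol q\|=(\|q_1\|^2+\|q_2\|^2)^{1/2}$ for $\boldsymbol q=(q_1,q_2)^\top$. For an integer $m\ge 0$ let $H^m_p(D)$ be the space of complex-valued $2L$-periodic functions whose weak (periodic) derivatives of order at most $m$ all lie in $L^2(D)$. Let $\delta,\Omega,\mu_1,\mu_2,\beta_{jl}$ $(j,l=1,2)$ be real constants, $V\in L^2(D)$ a real potential, and $\phi_1,\phi_2\in L^4(D)$ complex-valued functions (for instance the components of a smooth or finite-energy ground state). The Bogoliubov–de Gennes operators are $$\mathcal A=\begin{bmatrix}L_1&\beta_{12}\phi_1\overline{\phi_2}+\frac{\Omega}{2}\\ \beta_{21}\overline{\phi_1}\phi_2+\frac{\Omega}{2}&L_2\end{bmatrix},\qquad \mathcal B=\begin{bmatrix}\beta_{11}\phi_1^2&\beta_{12}\phi_1\phi_2\\ \beta_{21}\phi_1\phi_2&\beta_{22}\phi_2^2\end{bmatrix},$$ $$L_1=-\tfrac12\nabla^2+V+\tfrac{\delta}{2}+2\beta_{11}|\phi_1|^2+\beta_{12}|\phi_2|^2-\mu_1,\qquad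 L_2=-\tfrac12\nabla^2+V-\tfrac{\delta}{2}+\beta_{21}|\phi_1|^2+2\beta_{22}|\phi_2|^2-\mu_2 .$$ For a positive even integer $N$ and a continuous $2L$-periodic function $f$, the Fourier pseudo-spectral approximation of $f$ is $$\widetilde f(\boldsymbol x)=\sum_{k\in\{-N/2,\dots,N/2-1\}^d}\widehat f_k\,W_k(\boldsymbol x),\qquad W_k(\boldsymbol x)=\prod_{j=1}^d e^{i\pi k_j(x_j+L)/L},\qquad \widehat f_k=\frac1{N^d}\sum_{n\in\{0,\dots,N-1\}^d}f(\boldsymbol x_n)\overline{W_k(\boldsymbol x_n)},$$ where $(\boldsymbol x_n)_j=-L+2Ln_j/N$. Theorem. Let $m$ be an integer with $m>d/2+2$ and let $\boldsymbol q=(q_1,q_2)^\top\in (H^m_p(D))^2$. Then $q_1,q_2$ have continuous $2L$-periodic representatives and, with $\widetilde{\boldsymbol q}=(\widetilde q_1,\widetilde q_2)^\top$ the Fourier pseudo-spectral approximations of these representatives, there is a constant $c>0$, independent of $N$, such that for every positive even integer $N$ $$\|\mathcal Q\boldsymbol q-\mathcal Q\widetilde{\boldsymbol q}\|\le c\,N^{-(m-2)}\qquad\text{for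 }\mathcal Q=\mathcal A\text{ and for }\mathcal Q=\mathcal B .$$ -/

import Mathlib

open MeasureTheory
open scoped ContDiff ENNReal

noncomputable section

namespace BdG

variable {d : ℕ}

/-- The computational domain `[-L, L]^d`. -/
def box (d : ℕ) (L : ℝ) : Set (Fin d → ℝ) :=
  Set.Icc (fun _ => -L) (fun _ => L)

/-- Lebesgue measure on the computational domain. -/
def boxMeasure (d : ℕ) (L : ℝ) : Measure (Fin d → ℝ) :=
  volume.restrict (box d L)

/-- `f` is `2L`-periodic in every coordinate direction. -/
def IsPeriodic (L : ℝ) (f : (Fin d → ℝ) → ℂ) : Prop :=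
  ∀ (i : Fin d) (x : Fin d → ℝ), f (x + Pi.single i (2 * L)) = f x

/-- The classical partial derivative `∂f/∂x_i`. -/
def partialDeriv (i : Fin d) (f : (Fin d → ℝ) → ℂ) : (Fin d → ℝ) → ℂ :=
  fun x => fderiv ℝ f x (Pi.single i 1)

/-- The classical derivative `∂^α = ∂_{x_1}^{α_1} ⋯ ∂_{x_d}^{α_d}` (applied to smooth functions
below). -/
def multiDeriv (α : Fin d → ℕ) (f : (Fin d → ℝ) → ℂ) : (Fin d → ℝ) → ℂ :=
  (List.finRange d).foldr (fun i g => (partialDeriv i)^[α i] g) f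

/-- `g` in `L²([-L, L]^d)` is the weak `α`-th derivative of `f` on the `2L`-periodic torus:
`∫ f ∂^α φ = (-1)^|α| ∫ g φ` for all smooth `2L`-periodic test functions `φ`. -/
def HasWeakDeriv (L : ℝ) (α : Fin d → ℕ) (f g : (Fin d → ℝ) → ℂ) : Prop :=
  MemLp g 2 (boxMeasure d L) ∧
    ∀ φ : (Fin d → ℝ) → ℂ, ContDiff ℝ ∞ φ → IsPeriodic L φ →
      ∫ x, f x * multiDeriv α φ x ∂(boxMeasure d L)
        = (-1) ^ (∑ i, α i) * ∫ x, g x * φ x ∂(boxMeasure d L)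

/-- Membership in the `2L`-periodic Sobolev space `H^m_p`: a `2L`-periodic function,
square integrable on the box, all of whose weak derivatives of order at most `m` are square
integrable on the box. (Functions are representatives of their a.e. classes.) -/
def MemHp (L : ℝ) (m : ℕ) (f : (Fin d → ℝ) → ℂ) : Prop :=
  IsPeriodic L f ∧ MemLp f 2 (boxMeasure d L) ∧
    ∀ α : Fin d → ℕ, ∑ i, α i ≤ m → ∃ g, HasWeakDeriv L α f g

open Classical in
/-- The weak derivative `∂^α f` (unique up to null sets), with value `0` where there is none. -/
def weakDeriv (L : ℝ) (α : Fin d → ℕ) (f : (Fin d → ℝ) → ℂ) : (Fin d → ℝ) → ℂ :=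
  if h : ∃ g, HasWeakDeriv L α f g then h.choose else 0

/-- The (weak) Laplacian `∑ i, ∂²f/∂x_i²`. -/
def laplacian (L : ℝ) (f : (Fin d → ℝ) → ℂ) : (Fin d → ℝ) → ℂ :=
  fun x => ∑ i, weakDeriv L (Pi.single i 2) f x

/-- `p` is the continuous `2L`-periodic representative of `f`. -/
def IsContinuousRep (L : ℝ) (f p : (Fin d → ℝ) → ℂ) : Prop :=
  Continuous p ∧ IsPeriodic L p ∧ p =ᵐ[boxMeasure d L] f

/-- The grid point with index `n`, with coordinates `-L + n_i h`, `h = 2L / N`. -/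
def gridPoint (L : ℝ) (N : ℕ) (n : Fin d → Fin N) : Fin d → ℝ :=
  fun i => -L + ((n i : ℕ) : ℝ) * (2 * L / N)

/-- The plane wave `W_k(x) = ∏_j exp(i μ_{k_j} (x_j + L))` with `μ_k = π k / L`. -/
def planeWave (L : ℝ) (k : Fin d → ℤ) (x : Fin d → ℝ) : ℂ :=
  ∏ j, Complex.exp (Complex.I * ((Real.pi * (k j : ℝ) / L * (x j + L) : ℝ) : ℂ))

/-- The discrete Fourier coefficient of the grid values of `f`. -/
def discreteCoeff (L : ℝ) (N : ℕ) (f : (Fin d → ℝ) → ℂ) (k : Fin d → ℤ) : ℂ :=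
  1 / (N : ℂ) ^ d *
    ∑ n : Fin d → Fin N,
      f (gridPoint L N n) * (starRingEnd ℂ) (planeWave L k (gridPoint L N n))

/-- The frequencies `k` with `-N/2 ≤ k_j ≤ N/2 - 1` (used for even `N`). -/
def frequencies (d N : ℕ) : Finset (Fin d → ℤ) :=
  Fintype.piFinset fun _ => Finset.Icc (-((N : ℤ) / 2)) ((N : ℤ) / 2 - 1)

/-- The Fourier pseudo-spectral approximation (trigonometric interpolant) of `f` on the grid with
`N` points in each direction. -/
def interpolant (L : ℝ) (N : ℕ) (f : (Fin d → ℝ) → ℂ) : (Fin d → ℝ) → ℂ :=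
  fun x => ∑ k ∈ frequencies d N, discreteCoeff L N f k * planeWave L k x

/-- The data in the Bogoliubov-de Gennes operators: trapping potential `V`, detuning `δ`, Rabi
frequency `Ω`, interaction strengths `β`, chemical potentials `μ` (with an internal Josephson
junction `μ 0 = μ 1 = μ_g`; without one `Ω = 0`), and the state `φ = (φ_1, φ_2)`
about which one linearizes. -/
structure Data (d : ℕ) where
  V : (Fin d → ℝ) → ℝ
  δ : ℝ
  Ω : ℝ
  β : Fin 2 → Fin 2 → ℝ
  μ : Fin 2 → ℝ
  φ : Fin 2 → (Fin d → ℝ) → ℂ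

/-- `L_1 = -½∇² + V + δ/2 + 2 β_11 |φ_1|² + β_12 |φ_2|² - μ_1`. -/
def opL₁ (L : ℝ) (P : Data d) (f : (Fin d → ℝ) → ℂ) : (Fin d → ℝ) → ℂ :=
  fun x => -(1 / 2) * laplacian L f x
    + ((P.V x + P.δ / 2 + 2 * P.β 0 0 * ‖P.φ 0 x‖ ^ 2 + P.β 0 1 * ‖P.φ 1 x‖ ^ 2
        - P.μ 0 : ℝ) : ℂ) * f x

/-- `L_2 = -½∇² + V - δ/2 + β_21 |φ_1|² + 2 β_22 |φ_2|² - μ_2`. -/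
def opL₂ (L : ℝ) (P : Data d) (f : (Fin d → ℝ) → ℂ) : (Fin d → ℝ) → ℂ :=
  fun x => -(1 / 2) * laplacian L f x
    + ((P.V x - P.δ / 2 + P.β 1 0 * ‖P.φ 0 x‖ ^ 2 + 2 * P.β 1 1 * ‖P.φ 1 x‖ ^ 2
        - P.μ 1 : ℝ) : ℂ) * f x

/-- `𝒜 = [L_1, β_12 φ_1 conj(φ_2) + Ω/2; β_21 conj(φ_1) φ_2 + Ω/2, L_2]`. -/
def opA (L : ℝ) (P : Data d) (q : Fin 2 → (Fin d → ℝ) → ℂ) : Fin 2 → (Fin d → ℝ) → ℂ :=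
  ![fun x => opL₁ L P (q 0) x
      + (P.β 0 1 * P.φ 0 x * (starRingEnd ℂ) (P.φ 1 x) + P.Ω / 2) * q 1 x,
    fun x => (P.β 1 0 * (starRingEnd ℂ) (P.φ 0 x) * P.φ 1 x + P.Ω / 2) * q 0 x
      + opL₂ L P (q 1) x]

/-- `ℬ = [β_11 φ_1², β_12 φ_1 φ_2; β_21 φ_1 φ_2, β_22 φ_2²]`. -/
def opB (P : Data d) (q : Fin 2 → (Fin d → ℝ) → ℂ) : Fin 2 → (Fin d → ℝ) → ℂ :=
  ![fun x => P.β 0 0 * P.φ 0 x ^ 2 * q 0 x + P.β 0 1 * P.φ 0 x * P.φ 1 x * q 1 x,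
    fun x => P.β 1 0 * P.φ 0 x * P.φ 1 x * q 0 x + P.β 1 1 * P.φ 1 x ^ 2 * q 1 x]

/-- The norm `‖q‖ = (‖q_1‖² + ‖q_2‖²)^{1/2}` of `L²([-L, L]^d)²`, with values in `[0, ∞]`. -/
def vecNorm (L : ℝ) (q : Fin 2 → (Fin d → ℝ) → ℂ) : ℝ≥0∞ :=
  (∑ j, eLpNorm (q j) 2 (boxMeasure d L) ^ 2) ^ (1 / 2 : ℝ)

end BdG

end

/-!
On the Fourier side both claims concern the coefficients `a_k` of a component of `q`. Testing the
weak derivatives `∂_i^m` against plane waves shows that membership in `H^m_p` makes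
`∑ (1 + |k|)^{2m} |a_k|²` finite, where `|k| = max |k_i|` (`MemHp.summable_weighted_sq_coeff`).
Since `m > d/2`, the series `∑ a_k W_k` converges absolutely, and its sum is the continuous
representative (`exists_isContinuousRep_of_summable_coeff`).

Sampling on the grid folds the frequency `k + N l` onto `k`: the discrete coefficients are
`∑_l a_{k + N l}` (`hasSum_alias_discreteCoeff`). Hence the interpolation error has the coefficients
`e_k = a_k` outside the frequency window and `e_k = -∑_{l ≠ 0} a_{k + N l}` inside it. By the
Cauchy–Schwarz inequality, the bound `|k + N l| ≥ N |l| / 2` for `k` in the window and `l ≠ 0`, and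
the fact that the window is a set of representatives modulo `N`, this yields
`∑ (1 + |k|)^4 |e_k|² ≤ C N^{-2(m-2)}` (`exists_tsum_weighted_sq_aliasError_le`).

This `H²` bound controls the two terms of the operators. By Parseval's identity the weak second
derivatives of the error are `O(N^{-(m-2)})` in `L²`. As `∑ (1 + |k|)^{-4}` converges for `d ≤ 3`,
the error itself is `O(N^{-(m-2)})` in the supremum norm, and multiplication by the remaining
coefficients, which lie in `L²` because `V ∈ L²` and `φ_j ∈ L⁴`, is bounded from `L^∞` to `L²`.

Mathlib's Fourier theory lives on `UnitAddTorus`. The section `toBox` of the covering map carries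
the Haar probability measure to `(2L)^{-d}` times Lebesgue measure on the box, so that `L²`
functions on the box, periodic or not, pull back to `L²` functions on the torus.
-/

namespace BdG

open UnitAddTorus

-- The measure on the torus is the Haar probability measure used by Mathlib's `mFourier` theory.
attribute [local instance] instMeasureSpaceUnitAddCircle
  instIsProbabilityMeasureUnitAddCircleVolume

/-! ### Transfer from the box to the unit torus -/

/-- The fundamental-domain section `UnitAddTorus → (-L, L]^d`. -/
noncomputable def toBox {d : ℕ} (L : ℝ) (t : UnitAddTorus (Fin d)) : Fin d → ℝ :=
  fun i => 2 * L * (AddCircle.equivIoc 1 0 (t i) : ℝ) + -L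

/-- The covering map `ℝ^d → UnitAddTorus` that identifies points differing by periods `2L`. -/
noncomputable def toTorus {d : ℕ} (L : ℝ) (x : Fin d → ℝ) : UnitAddTorus (Fin d) :=
  fun i => (((x i + L) / (2 * L) : ℝ) : UnitAddCircle)

lemma toTorus_toBox {d : ℕ} {L : ℝ} (hL : 0 < L) (t : UnitAddTorus (Fin d)) :
    toTorus L (toBox L t) = t := by
  ext i
  have : (2 * L * (AddCircle.equivIoc 1 0 (t i) : ℝ) + -L + L) / (2 * L)
      = (AddCircle.equivIoc 1 0 (t i) : ℝ) := by field_simp; ring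
  simp only [toTorus, toBox, this]
  exact (AddCircle.equivIoc 1 0).symm_apply_apply (t i)

lemma continuous_toTorus {d : ℕ} (L : ℝ) : Continuous (toTorus (d := d) L) := by
  refine continuous_pi fun i => ?_
  exact (AddCircle.continuous_mk' 1).comp (by fun_prop)

lemma toTorus_add_period {d : ℕ} {L : ℝ} (hL : 0 < L) (i : Fin d) (x : Fin d → ℝ) :
    toTorus L (x + Pi.single i (2 * L)) = toTorus L x := by
  ext j
  rcases eq_or_ne j i with rfl | h
  · have : (x j + 2 * L + L) / (2 * L) = (x j + L) / (2 * L) + 1 := by field_simp; ring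
    simp [toTorus, this]
  · simp [toTorus, h]

lemma planeWave_eq_mFourier {d : ℕ} {L : ℝ} (hL : 0 < L) (k : Fin d → ℤ) (x : Fin d → ℝ) :
    planeWave L k x = mFourier k (toTorus L x) := by
  simp only [planeWave, mFourier, ContinuousMap.coe_mk, toTorus, fourier_coe_apply]
  refine Finset.prod_congr rfl fun j _ => ?_
  congr 1
  have : (L : ℂ) ≠ 0 := by exact_mod_cast hL.ne'
  push_cast
  field_simp

lemma measurePreserving_affine_Ioc {L : ℝ} (hL : 0 < L) :
    MeasurePreserving (fun x : ℝ => 2 * L * x + -L) (volume.restrict (Set.Ioc 0 1))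
      (ENNReal.ofReal (1 / (2 * L)) • volume.restrict (Set.Icc (-L) L)) := by
  have h1 : MeasurePreserving (fun x : ℝ => 2 * L * x + -L) volume
      (ENNReal.ofReal (1 / (2 * L)) • volume) := by
    refine ⟨by fun_prop, ?_⟩
    have : (fun x : ℝ => 2 * L * x + -L) = (fun x => x + -L) ∘ (fun x => 2 * L * x) := rfl
    rw [this, ← Measure.map_map (by fun_prop) (by fun_prop),
      Real.map_volume_mul_left (by positivity), Measure.map_smul, map_add_right_eq_self,
      abs_of_pos (by positivity), one_div]
  have h2 := h1.restrict_preimage (measurableSet_Ioc (a := -L) (b := L))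
  have h3 : (fun x : ℝ => 2 * L * x + -L) ⁻¹' Set.Ioc (-L) L = Set.Ioc 0 1 := by
    ext x
    simp only [Set.mem_preimage, Set.mem_Ioc]
    constructor
    · rintro ⟨h, h'⟩
      constructor <;> nlinarith
    · rintro ⟨h, h'⟩
      constructor <;> nlinarith
  rw [h3, Measure.restrict_smul, Measure.restrict_congr_set (Ioc_ae_eq_Icc (a := -L))] at h2
  exact h2

lemma measurePreserving_equivIoc_coe :
    MeasurePreserving (fun t : UnitAddCircle => (AddCircle.equivIoc 1 0 t : ℝ)) volume
      (volume.restrict (Set.Ioc 0 1)) := by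
  have h := AddCircle.measurePreserving_equivIoc 1 (a := 0)
  have h2 : MeasurePreserving (Subtype.val : Set.Ioc (0 : ℝ) (0 + 1) → ℝ)
      (Measure.comap Subtype.val volume) (volume.restrict (Set.Ioc 0 (0 + 1))) :=
    ⟨measurable_subtype_coe, map_comap_subtype_coe measurableSet_Ioc _⟩
  have h3 := h2.comp h
  rw [AddCircle.volume_eq_smul_haarAddCircle, ENNReal.ofReal_one, one_smul] at h3
  simp only [zero_add] at h3
  exact h3

/-- The normalisation factor `(2L)^{-d}`. -/
noncomputable def boxWeight (d : ℕ) (L : ℝ) : ℝ := (1 / (2 * L)) ^ d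

lemma measurePreserving_toBox {d : ℕ} {L : ℝ} (hL : 0 < L) :
    MeasurePreserving (toBox (d := d) L) volume
      (ENNReal.ofReal (boxWeight d L) • boxMeasure d L) := by
  have h1 := (measurePreserving_affine_Ioc hL).comp measurePreserving_equivIoc_coe
  have h2 := measurePreserving_pi (fun _ : Fin d => (volume : Measure UnitAddCircle))
    (fun _ => ENNReal.ofReal (1 / (2 * L)) • volume.restrict (Set.Icc (-L) L))
    (hν := fun _ => by
      have : IsFiniteMeasure (ENNReal.ofReal (1 / (2 * L)) • volume.restrict (Set.Icc (-L) L)) :=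
        Measure.smul_finite _ ENNReal.ofReal_ne_top
      infer_instance) (fun _ => h1)
  have h3 : Measure.pi (fun _ : Fin d =>
      ENNReal.ofReal (1 / (2 * L)) • (volume : Measure ℝ).restrict (Set.Icc (-L) L))
      = ENNReal.ofReal (boxWeight d L) • boxMeasure d L := by
    have : IsFiniteMeasure (ENNReal.ofReal (1 / (2 * L)) • volume.restrict (Set.Icc (-L) L)) :=
        Measure.smul_finite _ ENNReal.ofReal_ne_top
    refine Measure.pi_eq fun s hs => ?_
    rw [boxMeasure, box, ← Set.pi_univ_Icc, volume_pi, Measure.restrict_pi_pi]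
    simp [Measure.pi_pi, Finset.prod_mul_distrib, boxWeight, ENNReal.ofReal_pow, hL.le]
  rw [h3] at h2
  exact h2

/-! ### Fourier coefficients and Parseval's identity on the box -/

/-- The `k`-th Fourier coefficient `(2L)^{-d} ∫ f conj(W_k)` on the box, using
`conj(W_k) = W_{-k}`. -/
noncomputable def coeff {d : ℕ} (L : ℝ) (f : (Fin d → ℝ) → ℂ) (k : Fin d → ℤ) : ℂ :=
  (boxWeight d L : ℂ) * ∫ x, planeWave L (-k) x * f x ∂(boxMeasure d L)

lemma boxWeight_pos {L : ℝ} (hL : 0 < L) (d : ℕ) : 0 < boxWeight d L := by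
  unfold boxWeight; positivity

lemma continuous_planeWave {d : ℕ} {L : ℝ} (hL : 0 < L) (k : Fin d → ℤ) :
    Continuous (planeWave L k) := by
  simp only [funext (planeWave_eq_mFourier hL k)]
  exact (mFourier k).continuous.comp (continuous_toTorus L)

lemma norm_planeWave {d : ℕ} (L : ℝ) (k : Fin d → ℤ) (x : Fin d → ℝ) :
    ‖planeWave L k x‖ = 1 := by
  simp only [planeWave, norm_prod]
  refine Finset.prod_eq_one fun j _ => ?_
  rw [mul_comm, Complex.norm_exp_ofReal_mul_I]

lemma planeWave_neg {d : ℕ} (L : ℝ) (k : Fin d → ℤ) (x : Fin d → ℝ) :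
    planeWave L (-k) x = (starRingEnd ℂ) (planeWave L k x) := by
  simp only [planeWave, map_prod]
  refine Finset.prod_congr rfl fun j _ => ?_
  rw [← Complex.exp_conj, map_mul, Complex.conj_I, Complex.conj_ofReal]
  congr 1
  simp only [Pi.neg_apply]
  push_cast
  ring

lemma planeWave_add {d : ℕ} (L : ℝ) (k l : Fin d → ℤ) (x : Fin d → ℝ) :
    planeWave L (k + l) x = planeWave L k x * planeWave L l x := by
  simp only [planeWave, ← Finset.prod_mul_distrib, ← Complex.exp_add]
  refine Finset.prod_congr rfl fun j _ => ?_
  congr 1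
  simp only [Pi.add_apply]
  push_cast
  ring

instance isFiniteMeasure_boxMeasure (d : ℕ) (L : ℝ) : IsFiniteMeasure (boxMeasure d L) :=
  ⟨by rw [boxMeasure, box, Measure.restrict_apply_univ]; exact isCompact_Icc.measure_lt_top⟩

lemma MemLp.comp_toBox {d : ℕ} {L : ℝ} (hL : 0 < L) {f : (Fin d → ℝ) → ℂ} {p : ℝ≥0∞}
    (hf : MemLp f p (boxMeasure d L)) :
    MemLp (f ∘ toBox L) p (volume : Measure (UnitAddTorus (Fin d))) :=
  (hf.smul_measure ENNReal.ofReal_ne_top).comp_measurePreserving (measurePreserving_toBox hL)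

lemma mFourierCoeff_comp_toBox {d : ℕ} {L : ℝ} (hL : 0 < L) {f : (Fin d → ℝ) → ℂ}
    (hf : AEStronglyMeasurable f (boxMeasure d L)) (k : Fin d → ℤ) :
    mFourierCoeff (f ∘ toBox L) k = coeff L f k := by
  have h := measurePreserving_toBox (d := d) hL
  have hm : AEStronglyMeasurable (fun x => planeWave L (-k) x * f x)
      (Measure.map (toBox L) (volume : Measure (UnitAddTorus (Fin d)))) := by
    rw [h.map_eq]
    exact (((continuous_planeWave hL _).aestronglyMeasurable).mul hf).smul_measure _
  have h2 := integral_map h.measurable.aemeasurable hm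
  rw [h.map_eq, integral_smul_measure, ENNReal.toReal_ofReal (boxWeight_pos hL d).le] at h2
  rw [coeff, ← Complex.real_smul, h2, mFourierCoeff]
  refine integral_congr_ae (Filter.Eventually.of_forall fun t => ?_)
  simp [planeWave_eq_mFourier hL, toTorus_toBox hL]

lemma hasSum_sq_coeff {d : ℕ} {L : ℝ} (hL : 0 < L) {f : (Fin d → ℝ) → ℂ}
    (hf : MemLp f 2 (boxMeasure d L)) :
    HasSum (fun k => ‖coeff L f k‖ ^ 2) (∫ t, ‖f (toBox L t)‖ ^ 2) := by
  have h := hasSum_sq_mFourierCoeff (MemLp.comp_toBox hL hf).toLp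
  have hae := (MemLp.comp_toBox hL hf).coeFn_toLp
  convert h using 1
  · funext k
    rw [← mFourierCoeff_comp_toBox hL hf.1]
    congr 2
    refine integral_congr_ae ?_
    filter_upwards [hae] with t ht
    rw [ht]
  · refine integral_congr_ae ?_
    filter_upwards [hae] with t ht
    rw [ht]
    rfl

/-- **Parseval's identity** on the box, as an upper bound for the `L²` norm. -/
lemma eLpNorm_le_of_tsum_sq_coeff_le {d : ℕ} {L : ℝ} (hL : 0 < L) {f : (Fin d → ℝ) → ℂ}
    (hf : MemLp f 2 (boxMeasure d L)) {B : ℝ} (hB : 0 ≤ B)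
    (h : ∑' k, ‖coeff L f k‖ ^ 2 ≤ B ^ 2) :
    eLpNorm f 2 (boxMeasure d L) ≤ ENNReal.ofReal ((Real.sqrt (boxWeight d L))⁻¹ * B) := by
  have hw := boxWeight_pos hL d
  rw [(hasSum_sq_coeff hL hf).tsum_eq] at h
  have h1 := eLpNorm_comp_measurePreserving (p := 2)
    (hf.1.smul_measure (ENNReal.ofReal (boxWeight d L))) (measurePreserving_toBox (d := d) hL)
  rw [(MemLp.comp_toBox hL hf).eLpNorm_eq_integral_rpow_norm (by simp) (by simp),
    eLpNorm_smul_measure_of_ne_top (by simp)] at h1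
  simp only [ENNReal.toReal_ofNat, Real.rpow_ofNat, Function.comp, smul_eq_mul, one_div,
    ENNReal.toReal_inv] at h1
  rw [ENNReal.ofReal_rpow_of_pos hw] at h1
  have h2 : (∫ t, ‖f (toBox L t)‖ ^ 2) ^ (2 : ℝ)⁻¹ ≤ B := by
    rw [← one_div, ← Real.sqrt_eq_rpow]
    exact Real.sqrt_le_iff.2 ⟨hB, h⟩
  have h3 := h1.symm.le.trans (ENNReal.ofReal_le_ofReal h2)
  rw [← one_div, ← Real.sqrt_eq_rpow] at h3
  have hs : 0 < Real.sqrt (boxWeight d L) := Real.sqrt_pos.2 hw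
  calc eLpNorm f 2 (boxMeasure d L)
      = ENNReal.ofReal (Real.sqrt (boxWeight d L))⁻¹
        * (ENNReal.ofReal (Real.sqrt (boxWeight d L)) * eLpNorm f 2 (boxMeasure d L)) := by
        rw [← mul_assoc, ← ENNReal.ofReal_mul (by positivity), inv_mul_cancel₀ hs.ne',
          ENNReal.ofReal_one, one_mul]
    _ ≤ ENNReal.ofReal (Real.sqrt (boxWeight d L))⁻¹ * ENNReal.ofReal B := by
        gcongr
    _ = _ := by rw [← ENNReal.ofReal_mul (by positivity)]

/-- A square integrable function with summable Fourier coefficients has a continuous periodic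
representative, the pointwise sum of its Fourier series. -/
lemma exists_isContinuousRep_of_summable_coeff {d : ℕ} {L : ℝ} (hL : 0 < L)
    {f : (Fin d → ℝ) → ℂ} (hf : MemLp f 2 (boxMeasure d L)) (h : Summable (coeff L f)) :
    ∃ p, IsContinuousRep L f p ∧ ∀ x, HasSum (fun k => coeff L f k * planeWave L k x) (p x) := by
  have hs : Summable (fun k => coeff L f k • (mFourier k : C(UnitAddTorus (Fin d), ℂ))) := by
    refine .of_norm ?_
    simpa only [norm_smul, mFourier_norm, mul_one] using h.norm
  obtain ⟨g, hg⟩ := hs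
  have hfT := MemLp.comp_toBox hL hf
  refine ⟨fun x => g (toTorus L x), ⟨g.continuous.comp (continuous_toTorus L), fun i x => ?_, ?_⟩,
    fun x => ?_⟩
  · simp only [toTorus_add_period hL]
  · have h1 : HasSum (fun k => coeff L f k • mFourierLp 2 k)
        (ContinuousMap.toLp (E := ℂ) 2 volume ℂ g) := by
      have := (ContinuousMap.toLp (E := ℂ) (α := UnitAddTorus (Fin d)) 2 volume ℂ).hasSum hg
      simpa only [map_smul] using this
    have h2 := hasSum_mFourier_series_L2 hfT.toLp
    have h3 : ∀ k, mFourierCoeff hfT.toLp k = coeff L f k := fun k => by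
      rw [← mFourierCoeff_comp_toBox hL hf.1]
      refine integral_congr_ae ?_
      filter_upwards [hfT.coeFn_toLp] with t ht
      rw [ht]
    simp only [h3] at h2
    have h4 := h1.unique h2
    have h5 : (g : UnitAddTorus (Fin d) → ℂ) =ᵐ[volume] f ∘ toBox L := by
      refine (ContinuousMap.coeFn_toLp (𝕜 := ℂ) (p := 2) volume g).symm.trans ?_
      rw [h4]
      exact hfT.coeFn_toLp
    have hm : AEStronglyMeasurable (fun x => g (toTorus L x) - f x) (boxMeasure d L) :=
      (g.continuous.comp (continuous_toTorus L)).aestronglyMeasurable.sub hf.1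
    have h6 : eLpNorm (fun x => g (toTorus L x) - f x) 2
        (ENNReal.ofReal (boxWeight d L) • boxMeasure d L) = 0 := by
      rw [← eLpNorm_comp_measurePreserving (hm.smul_measure _) (measurePreserving_toBox hL)]
      refine (eLpNorm_congr_ae (g := 0) ?_).trans eLpNorm_zero
      filter_upwards [h5] with t ht
      simp only [Function.comp, toTorus_toBox hL, Pi.zero_apply] at ht ⊢
      rw [ht, sub_self]
    rw [eLpNorm_smul_measure_of_ne_top (by simp), smul_eq_mul, mul_eq_zero,
      eLpNorm_eq_zero_iff hm (by simp)] at h6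
    rcases h6 with h6 | h6
    · have := ENNReal.ofReal_pos.2 (boxWeight_pos hL d)
      exact absurd h6 (by simp [boxWeight_pos hL d])
    · filter_upwards [h6] with x hx
      exact sub_eq_zero.1 hx
  · have := (ContinuousMap.evalCLM ℂ (toTorus L x)).hasSum hg
    simpa [planeWave_eq_mFourier hL] using this

lemma coeff_planeWave {d : ℕ} {L : ℝ} (hL : 0 < L) (k l : Fin d → ℤ) :
    coeff L (planeWave L k) l = if l = k then 1 else 0 := by
  have h := orthonormal_iff_ite.1 (orthonormal_mFourier (d := Fin d)) l k
  rw [← h, ContinuousMap.inner_toLp, ← mFourierCoeff_comp_toBox hL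
    (continuous_planeWave hL k).aestronglyMeasurable]
  refine integral_congr_ae (Filter.Eventually.of_forall fun t => ?_)
  simp [planeWave_eq_mFourier hL, toTorus_toBox hL, mFourier_neg, mul_comm]

lemma integrable_planeWave_mul {d : ℕ} {L : ℝ} (hL : 0 < L) {f : (Fin d → ℝ) → ℂ}
    (hf : MemLp f 2 (boxMeasure d L)) (k : Fin d → ℤ) :
    Integrable (fun x => planeWave L k x * f x) (boxMeasure d L) :=
  (hf.integrable (by norm_num)).bdd_mul (c := 1)
    (continuous_planeWave hL k).aestronglyMeasurable
    (Filter.Eventually.of_forall fun x => (norm_planeWave L k x).le)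

lemma coeff_sub {d : ℕ} {L : ℝ} (hL : 0 < L) {f g : (Fin d → ℝ) → ℂ}
    (hf : MemLp f 2 (boxMeasure d L)) (hg : MemLp g 2 (boxMeasure d L)) (k : Fin d → ℤ) :
    coeff L (fun x => f x - g x) k = coeff L f k - coeff L g k := by
  simp only [coeff, mul_sub]
  rw [integral_sub (integrable_planeWave_mul hL hf _) (integrable_planeWave_mul hL hg _), mul_sub]

lemma memLp_planeWave {d : ℕ} {L : ℝ} (hL : 0 < L) (k : Fin d → ℤ) :
    MemLp (planeWave L k) 2 (boxMeasure d L) :=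
  MemLp.of_bound (continuous_planeWave hL k).aestronglyMeasurable 1
    (Filter.Eventually.of_forall fun x => (norm_planeWave L k x).le)

/-- Fourier coefficients of a trigonometric polynomial. -/
lemma coeff_sum_planeWave {d : ℕ} {L : ℝ} (hL : 0 < L) (s : Finset (Fin d → ℤ))
    (c : (Fin d → ℤ) → ℂ) (l : Fin d → ℤ) :
    coeff L (fun x => ∑ k ∈ s, c k * planeWave L k x) l = if l ∈ s then c l else 0 := by
  have h : coeff L (fun x => ∑ k ∈ s, c k * planeWave L k x) l
      = ∑ k ∈ s, c k * coeff L (planeWave L k) l := by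
    simp only [coeff, Finset.mul_sum]
    rw [integral_finsetSum _ fun k _ => ?_]
    · rw [Finset.mul_sum]
      refine Finset.sum_congr rfl fun k _ => ?_
      simp only [← integral_const_mul]
      refine integral_congr_ae (Filter.Eventually.of_forall fun x => ?_)
      simp only
      ring
    · have := (integrable_planeWave_mul hL (memLp_planeWave hL k) (-l)).const_mul (c k)
      refine this.congr (Filter.Eventually.of_forall fun x => ?_)
      simp only
      ring
  rw [h]
  simp [coeff_planeWave hL]

/-! ### Weak derivatives and their symbols -/

lemma multiDeriv_single {d : ℕ} (i : Fin d) (n : ℕ) (f : (Fin d → ℝ) → ℂ) :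
    multiDeriv (Pi.single i n) f = (partialDeriv i)^[n] f := by
  have key : ∀ l : List (Fin d), l.Nodup →
      l.foldr (fun j g => (partialDeriv j)^[(Pi.single i n : Fin d → ℕ) j] g) f
        = if i ∈ l then (partialDeriv i)^[n] f else f := by
    intro l
    induction l with
    | nil => simp
    | cons j l ih =>
      intro h
      rw [List.nodup_cons] at h
      rw [List.foldr_cons, ih h.2]
      rcases eq_or_ne j i with rfl | hj
      · simp [h.1]
      · simp [hj, hj.symm]
  rw [multiDeriv, key _ (List.nodup_finRange d), if_pos (List.mem_finRange i)]

lemma contDiff_partialDeriv {d : ℕ} (i : Fin d) {f : (Fin d → ℝ) → ℂ} (hf : ContDiff ℝ ∞ f) :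
    ContDiff ℝ ∞ (partialDeriv i f) :=
  (hf.fderiv_right (m := ∞) (by simp)).clm_apply contDiff_const

lemma IsPeriodic.partialDeriv {d : ℕ} {L : ℝ} (i : Fin d) {f : (Fin d → ℝ) → ℂ}
    (hf : IsPeriodic L f) : IsPeriodic L (partialDeriv i f) := by
  intro j x
  have : (fun y => f (y + Pi.single j (2 * L))) = f := funext (hf j)
  rw [BdG.partialDeriv, BdG.partialDeriv, ← fderiv_comp_add_right, this]

lemma IsPeriodic.mul {d : ℕ} {L : ℝ} {f g : (Fin d → ℝ) → ℂ}
    (hf : IsPeriodic L f) (hg : IsPeriodic L g) : IsPeriodic L (fun x => f x * g x) := by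
  intro j x
  simp only [hf j x, hg j x]

/-- The integral of a partial derivative of a periodic function over a period box vanishes: the
boundary terms in the divergence theorem cancel on opposite faces. -/
lemma integral_partialDeriv_eq_zero {d : ℕ} {L : ℝ} (hL : 0 < L) (i : Fin d)
    {f : (Fin d → ℝ) → ℂ} (hf : ContDiff ℝ ∞ f) (hp : IsPeriodic L f) :
    ∫ x, partialDeriv i f x ∂(boxMeasure d L) = 0 := by
  obtain ⟨n, rfl⟩ : ∃ n, d = n + 1 := ⟨d - 1, by have := i.pos; omega⟩
  have hd : Differentiable ℝ f := hf.differentiable (by simp)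
  have h := integral_divergence_of_hasFDerivAt_off_countable' (E := ℂ) (n := n)
    (fun _ => -L) (fun _ => L) (fun _ => by linarith)
    (fun j => if j = i then f else 0)
    (fun j x => if j = i then fderiv ℝ f x else 0) ∅ Set.countable_empty
    (fun j => by
      split_ifs
      · exact hf.continuous.continuousOn
      · exact continuousOn_const)
    (fun x _ j => by
      split_ifs
      · exact (hd x).hasFDerivAt
      · exact hasFDerivAt_const _ _)
    (by
      refine Continuous.integrableOn_Icc (continuous_finsetSum _ fun j _ => ?_)
      split_ifs
      · exact (hf.continuous_fderiv (by simp)).clm_apply continuous_const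
      · simpa using continuous_const)
  have hl : ∀ x : Fin (n + 1) → ℝ,
      ∑ j, (if j = i then fderiv ℝ f x else 0) (Pi.single j 1) = partialDeriv i f x := by
    intro x
    rw [Finset.sum_eq_single i]
    · simp [partialDeriv]
    · intro j _ hj
      simp [hj]
    · simp
  simp only [hl] at h
  rw [boxMeasure, box, h]
  refine Finset.sum_eq_zero fun j _ => ?_
  split_ifs with hj
  · subst hj
    rw [sub_eq_zero]
    congr 1
    funext y
    have := hp j (j.insertNth (-L) y)
    rw [← this]
    congr 1
    ext l
    refine Fin.succAboveCases j ?_ (fun l => ?_) l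
    · simp; ring
    · simp
  · simp

lemma partialDeriv_mul {d : ℕ} (i : Fin d) {f g : (Fin d → ℝ) → ℂ} (hf : ContDiff ℝ ∞ f)
    (hg : ContDiff ℝ ∞ g) (x : Fin d → ℝ) :
    partialDeriv i (fun x => f x * g x) x
      = f x * partialDeriv i g x + partialDeriv i f x * g x := by
  simp only [partialDeriv]
  rw [fderiv_fun_mul (hf.differentiable (by simp) x) (hg.differentiable (by simp) x)]
  simp [mul_comm]

lemma integrable_boxMeasure_of_continuous {d : ℕ} {L : ℝ} {f : (Fin d → ℝ) → ℂ}
    (hf : Continuous f) : Integrable f (boxMeasure d L) :=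
  hf.integrableOn_Icc

lemma integral_mul_partialDeriv {d : ℕ} {L : ℝ} (hL : 0 < L) (i : Fin d)
    {f g : (Fin d → ℝ) → ℂ} (hf : ContDiff ℝ ∞ f) (hg : ContDiff ℝ ∞ g)
    (hfp : IsPeriodic L f) (hgp : IsPeriodic L g) :
    ∫ x, f x * partialDeriv i g x ∂(boxMeasure d L)
      = -∫ x, partialDeriv i f x * g x ∂(boxMeasure d L) := by
  have h := integral_partialDeriv_eq_zero hL i (hf.mul hg) (hfp.mul hgp)
  simp only [partialDeriv_mul i hf hg] at h
  have h1 : Integrable (fun x => f x * partialDeriv i g x) (boxMeasure d L) :=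
    integrable_boxMeasure_of_continuous
      (hf.continuous.mul (contDiff_partialDeriv i hg).continuous)
  have h2 : Integrable (fun x => partialDeriv i f x * g x) (boxMeasure d L) :=
    integrable_boxMeasure_of_continuous
      ((contDiff_partialDeriv i hf).continuous.mul hg.continuous)
  rw [integral_add h1 h2] at h
  exact eq_neg_of_add_eq_zero_left h

lemma contDiff_iterate_partialDeriv {d : ℕ} (i : Fin d) (n : ℕ) {f : (Fin d → ℝ) → ℂ}
    (hf : ContDiff ℝ ∞ f) : ContDiff ℝ ∞ ((partialDeriv i)^[n] f) := by
  induction n with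
  | zero => exact hf
  | succ n ih => rw [Function.iterate_succ_apply']; exact contDiff_partialDeriv i ih

lemma IsPeriodic.iterate_partialDeriv {d : ℕ} {L : ℝ} (i : Fin d) (n : ℕ)
    {f : (Fin d → ℝ) → ℂ} (hf : IsPeriodic L f) :
    IsPeriodic L ((BdG.partialDeriv i)^[n] f) := by
  induction n with
  | zero => exact hf
  | succ n ih => rw [Function.iterate_succ_apply']; exact ih.partialDeriv i

lemma integral_mul_iterate_partialDeriv {d : ℕ} {L : ℝ} (hL : 0 < L) (i : Fin d) (n : ℕ)
    {f g : (Fin d → ℝ) → ℂ} (hf : ContDiff ℝ ∞ f) (hg : ContDiff ℝ ∞ g)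
    (hfp : IsPeriodic L f) (hgp : IsPeriodic L g) :
    ∫ x, f x * (partialDeriv i)^[n] g x ∂(boxMeasure d L)
      = (-1) ^ n * ∫ x, (partialDeriv i)^[n] f x * g x ∂(boxMeasure d L) := by
  induction n generalizing f with
  | zero => simp
  | succ n ih =>
    rw [Function.iterate_succ_apply', integral_mul_partialDeriv hL i hf
      (contDiff_iterate_partialDeriv i n hg) hfp (hgp.iterate_partialDeriv i n),
      ih (contDiff_partialDeriv i hf) (hfp.partialDeriv i), ← Function.iterate_succ_apply]
    ring

/-- A smooth periodic function has its classical derivatives as weak derivatives. -/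
lemma hasWeakDeriv_of_contDiff {d : ℕ} {L : ℝ} (hL : 0 < L) (i : Fin d) (n : ℕ)
    {f : (Fin d → ℝ) → ℂ} (hf : ContDiff ℝ ∞ f) (hp : IsPeriodic L f) :
    HasWeakDeriv L (Pi.single i n) f ((partialDeriv i)^[n] f) := by
  refine ⟨?_, fun φ hφ hφp => ?_⟩
  · have hc := (contDiff_iterate_partialDeriv i n hf).continuous
    have hbox : IsCompact (box d L) := isCompact_Icc
    obtain ⟨C, hC⟩ := hbox.exists_bound_of_continuousOn hc.continuousOn
    exact MemLp.of_bound hc.aestronglyMeasurable C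
      ((ae_restrict_iff' measurableSet_Icc).2 (Filter.Eventually.of_forall hC))
  · rw [multiDeriv_single, Finset.sum_pi_single', if_pos (Finset.mem_univ i)]
    exact integral_mul_iterate_partialDeriv hL i n hf hφ hp hφp

lemma planeWave_eq_exp {d : ℕ} (L : ℝ) (k : Fin d → ℤ) (x : Fin d → ℝ) :
    planeWave L k x
      = Complex.exp (∑ j, Complex.I * ((Real.pi * (k j : ℝ) / L * (x j + L) : ℝ) : ℂ)) :=
  (Complex.exp_sum _ _).symm

lemma contDiff_planeWave {d : ℕ} (L : ℝ) (k : Fin d → ℤ) : ContDiff ℝ ∞ (planeWave L k) := by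
  simp only [funext (planeWave_eq_exp L k)]
  refine ContDiff.cexp (ContDiff.sum fun j _ => contDiff_const.mul ?_)
  exact Complex.ofRealCLM.contDiff.comp
    (contDiff_const.mul ((contDiff_apply ℝ ℝ j).add contDiff_const))

lemma isPeriodic_planeWave {d : ℕ} {L : ℝ} (hL : 0 < L) (k : Fin d → ℤ) :
    IsPeriodic L (planeWave L k) := by
  intro i x
  simp only [planeWave_eq_mFourier hL, toTorus_add_period hL]

/-- The symbol `iπk_i/L` of the partial derivative `∂_i`. -/
noncomputable def symbol {d : ℕ} (L : ℝ) (i : Fin d) (k : Fin d → ℤ) : ℂ :=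
  Complex.I * ((Real.pi * (k i : ℝ) / L : ℝ) : ℂ)

lemma partialDeriv_planeWave {d : ℕ} (L : ℝ) (i : Fin d) (k : Fin d → ℤ) (c : ℂ) :
    partialDeriv i (fun x => c * planeWave L k x)
      = fun x => (c * symbol L i k) * planeWave L k x := by
  funext x
  have h1 : ∀ j, HasFDerivAt (fun y : Fin d → ℝ =>
      Complex.I * ((Real.pi * (k j : ℝ) / L * (y j + L) : ℝ) : ℂ))
      (Complex.I • (Complex.ofRealCLM.comp
        ((Real.pi * (k j : ℝ) / L) • ContinuousLinearMap.proj (R := ℝ) (φ := fun _ => ℝ) j))) x := by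
    intro j
    have h2 : HasFDerivAt (fun y : Fin d → ℝ => Real.pi * (k j : ℝ) / L * (y j + L))
        ((Real.pi * (k j : ℝ) / L) • ContinuousLinearMap.proj (R := ℝ) (φ := fun _ => ℝ) j) x :=
      ((ContinuousLinearMap.proj (R := ℝ) (φ := fun _ : Fin d => ℝ) j).hasFDerivAt.add_const
        L).const_mul _
    exact (Complex.ofRealCLM.hasFDerivAt.comp x h2).const_mul _
  have h3 := ((HasFDerivAt.fun_sum fun j (_ : j ∈ Finset.univ) => h1 j).cexp).const_mul c
  simp only [← planeWave_eq_exp] at h3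
  simp only [partialDeriv]
  rw [h3.fderiv]
  simp [symbol, Pi.single_apply, apply_ite Complex.ofReal]
  ring

lemma iterate_partialDeriv_planeWave {d : ℕ} (L : ℝ) (i : Fin d) (k : Fin d → ℤ) (n : ℕ) :
    (partialDeriv i)^[n] (planeWave L k) = fun x => symbol L i k ^ n * planeWave L k x := by
  induction n with
  | zero => simp
  | succ n ih => rw [Function.iterate_succ_apply', ih, partialDeriv_planeWave, pow_succ]

/-- Weak derivatives act on Fourier coefficients through their symbols. -/
lemma HasWeakDeriv.coeff_eq {d : ℕ} {L : ℝ} (hL : 0 < L) {i : Fin d} {n : ℕ}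
    {f g : (Fin d → ℝ) → ℂ} (h : HasWeakDeriv L (Pi.single i n) f g) (k : Fin d → ℤ) :
    coeff L g k = symbol L i k ^ n * coeff L f k := by
  have h1 := h.2 (planeWave L (-k)) (contDiff_planeWave L _) (isPeriodic_planeWave hL _)
  rw [multiDeriv_single, iterate_partialDeriv_planeWave, Finset.sum_pi_single',
    if_pos (Finset.mem_univ i)] at h1
  have hs : symbol L i (-k) = -1 * symbol L i k := by
    simp only [symbol, Pi.neg_apply]
    push_cast
    ring
  have h2 : ∀ x, f x * (symbol L i (-k) ^ n * planeWave L (-k) x)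
      = (-1) ^ n * (symbol L i k ^ n * (planeWave L (-k) x * f x)) := by
    intro x
    rw [hs, mul_pow]
    ring
  simp only [h2, integral_const_mul] at h1
  have h3 := mul_left_cancel₀ (pow_ne_zero n (by norm_num : (-1 : ℂ) ≠ 0)) h1
  simp only [coeff]
  rw [mul_left_comm, h3]
  simp only [mul_comm]

lemma norm_symbol {d : ℕ} {L : ℝ} (hL : 0 < L) (i : Fin d) (k : Fin d → ℤ) :
    ‖symbol L i k‖ = Real.pi / L * |(k i : ℝ)| := by
  rw [symbol, norm_mul, Complex.norm_I, one_mul, Complex.norm_real, Real.norm_eq_abs, abs_div,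
    abs_mul, abs_of_pos Real.pi_pos, abs_of_pos hL]
  ring

/-! ### Decay of the aliased coefficients -/

lemma summable_one_add_norm_pow_inv {d : ℕ} {r : ℕ} (hd : d < r) :
    Summable fun k : Fin d → ℤ => ((1 + ‖k‖) ^ r)⁻¹ := by
  set Λ := Submodule.span ℤ (Set.range (Pi.basisFun ℝ (Fin d)))
  have hr : Module.finrank ℤ Λ = d := by
    rw [ZLattice.rank ℝ Λ, Module.finrank_fin_fun]
  have h := ZLattice.summable_norm_pow_inv Λ r (by omega)
  have hmem : ∀ k : Fin d → ℤ, (fun i => (k i : ℝ)) ∈ Λ := fun k => by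
    rw [Module.Basis.mem_span_iff_repr_mem]
    intro i
    exact ⟨k i, by simp⟩
  have hinj : Function.Injective (fun k => ⟨fun i => (k i : ℝ), hmem k⟩ : (Fin d → ℤ) → Λ) := by
    intro k l hkl
    have := congrArg Subtype.val hkl
    funext i
    exact Int.cast_injective (α := ℝ) (congrFun this i)
  have h2 := h.comp_injective hinj
  have hn : ∀ k : Fin d → ℤ, ‖(⟨fun i => (k i : ℝ), hmem k⟩ : Λ)‖ = ‖k‖ := fun k => by
    change ‖(fun i => (k i : ℝ))‖ = ‖k‖
    simp only [Pi.norm_def]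
    rfl
  refine h2.of_norm_bounded_eventually ?_
  refine (Set.finite_singleton (0 : Fin d → ℤ)).subset fun k hk => ?_
  by_contra h0
  refine hk ?_
  have : 0 < ‖k‖ := norm_pos_iff.2 h0
  simp only [Function.comp, hn, Set.mem_ofPred_eq]
  rw [Real.norm_of_nonneg (by positivity), inv_pow]
  gcongr
  linarith

/-- The Cauchy–Schwarz inequality for series with nonnegative terms. -/
lemma summable_mul_and_tsum_mul_sq_le {ι : Type*} {f g : ι → ℝ} (hf : ∀ i, 0 ≤ f i)
    (hg : ∀ i, 0 ≤ g i) (hf2 : Summable fun i => f i ^ 2) (hg2 : Summable fun i => g i ^ 2) :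
    Summable (fun i => f i * g i) ∧
      (∑' i, f i * g i) ^ 2 ≤ (∑' i, f i ^ 2) * ∑' i, g i ^ 2 := by
  have h0 : 0 ≤ (∑' i, f i ^ 2) * ∑' i, g i ^ 2 :=
    mul_nonneg (tsum_nonneg fun i => sq_nonneg _) (tsum_nonneg fun i => sq_nonneg _)
  have h : ∀ s : Finset ι, ∑ i ∈ s, f i * g i
      ≤ Real.sqrt ((∑' i, f i ^ 2) * ∑' i, g i ^ 2) := fun s => by
    refine Real.le_sqrt_of_sq_le ((Finset.sum_mul_sq_le_sq_mul_sq s f g).trans ?_)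
    gcongr
    · exact hf2.sum_le_tsum s fun i _ => sq_nonneg _
    · exact hg2.sum_le_tsum s fun i _ => sq_nonneg _
  refine ⟨summable_of_sum_le (fun i => mul_nonneg (hf i) (hg i)) h, ?_⟩
  rw [← Real.sq_sqrt h0]
  have := Real.tsum_le_of_sum_le (fun i => mul_nonneg (hf i) (hg i)) h
  have h1 : 0 ≤ ∑' i, f i * g i := tsum_nonneg fun i => mul_nonneg (hf i) (hg i)
  gcongr

lemma mem_frequencies {d N : ℕ} {k : Fin d → ℤ} :
    k ∈ frequencies d N ↔ ∀ i, -((N : ℤ) / 2) ≤ k i ∧ k i ≤ (N : ℤ) / 2 - 1 := by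
  simp [frequencies]

/-- The frequencies form a set of representatives of `ℤ^d` modulo `N`. -/
lemma frequencies_add_smul_injective {d N : ℕ} (hN : 0 < N) :
    Function.Injective
      (fun p : frequencies d N × (Fin d → ℤ) => (p.1 : Fin d → ℤ) + (N : ℤ) • p.2) := by
  rintro ⟨⟨j, hj⟩, l⟩ ⟨⟨j', hj'⟩, l'⟩ h
  rw [mem_frequencies] at hj hj'
  have hi : ∀ i, l i = l' i := fun i => by
    have h1 := congrFun h i
    simp only [Pi.add_apply, Pi.smul_apply, smul_eq_mul] at h1
    have h2 := hj i
    have h3 := hj' i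
    have h4 : (N : ℤ) * (l i - l' i) = j' i - j i := by linarith
    have h5 : |(N : ℤ) * (l i - l' i)| < N * 1 := by
      rw [h4, abs_lt]
      constructor <;> omega
    rw [abs_mul, Nat.abs_cast] at h5
    have h6 := lt_of_mul_lt_mul_left h5 (by positivity)
    rw [Int.abs_lt_one_iff] at h6
    omega
  have hl : l = l' := funext hi
  subst hl
  simp only [add_left_inj] at h
  subst h
  rfl

lemma norm_le_of_mem_frequencies {d N : ℕ} (hN : Even N) {j : Fin d → ℤ}
    (hj : j ∈ frequencies d N) : ‖j‖ ≤ N / 2 := by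
  obtain ⟨M, rfl⟩ := hN
  rw [pi_norm_le_iff_of_nonneg (by positivity)]
  intro i
  have h := mem_frequencies.1 hj i
  have h1 : |j i| ≤ (M : ℤ) := abs_le.2 ⟨by omega, by omega⟩
  have h2 : ((|j i| : ℤ) : ℝ) ≤ M := by exact_mod_cast h1
  rw [Int.norm_eq_abs]
  push_cast at h2 ⊢
  linarith

lemma le_norm_of_notMem_frequencies {d N : ℕ} (hN : Even N) {k : Fin d → ℤ}
    (hk : k ∉ frequencies d N) : (N : ℝ) / 2 ≤ ‖k‖ := by
  obtain ⟨M, rfl⟩ := hN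
  simp only [mem_frequencies, not_forall] at hk
  obtain ⟨i, hi⟩ := hk
  have h1 : (M : ℤ) ≤ |k i| := by
    rw [le_abs]
    omega
  have h2 : (M : ℝ) ≤ ((|k i| : ℤ) : ℝ) := by exact_mod_cast h1
  refine le_trans ?_ (norm_le_pi_norm k i)
  rw [Int.norm_eq_abs]
  push_cast at h2 ⊢
  linarith

lemma one_le_norm_of_ne_zero {d : ℕ} {l : Fin d → ℤ} (hl : l ≠ 0) : 1 ≤ ‖l‖ := by
  obtain ⟨i, hi⟩ := Function.ne_iff.1 hl
  refine le_trans ?_ (norm_le_pi_norm l i)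
  rw [Int.norm_eq_abs]
  exact_mod_cast Int.one_le_abs hi

lemma one_add_norm_alias_ge {d N : ℕ} (hN : Even N) {j l : Fin d → ℤ}
    (hj : j ∈ frequencies d N) (hl : l ≠ 0) :
    (N : ℝ) / 4 * (1 + ‖l‖) ≤ 1 + ‖j + (N : ℤ) • l‖ := by
  have h1 := norm_le_of_mem_frequencies hN hj
  have h2 := one_le_norm_of_ne_zero hl
  have h3 : ‖(N : ℤ) • l‖ = N * ‖l‖ := by
    rw [norm_smul]
    simp
  have h4 : ‖(N : ℤ) • l‖ ≤ ‖j + (N : ℤ) • l‖ + ‖j‖ := by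
    have := norm_sub_le (j + (N : ℤ) • l) j
    rwa [add_sub_cancel_left] at this
  have h5 : (0 : ℝ) ≤ N := by positivity
  nlinarith

/-- The Fourier coefficients of the interpolation error of `∑ a_k W_k`: sampling on the grid folds
every frequency `k + N l` onto the frequency `k`. -/
noncomputable def aliasError {d : ℕ} (N : ℕ) (a : (Fin d → ℤ) → ℂ) (k : Fin d → ℤ) : ℂ :=
  a k - if k ∈ frequencies d N then ∑' l : Fin d → ℤ, a (k + (N : ℤ) • l) else 0

lemma alias_injective {d N : ℕ} (hN : 0 < N) (k : Fin d → ℤ) :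
    Function.Injective (fun l : Fin d → ℤ => k + (N : ℤ) • l) := by
  intro l l' h
  have h1 : (N : ℤ) • l = (N : ℤ) • l' := add_left_cancel h
  exact smul_right_injective _ (by exact_mod_cast hN.ne' : (N : ℤ) ≠ 0) h1

/-- Coefficients with finite `H^m` norm are absolutely summable, as soon as `m ≥ 2 > d/2`. -/
lemma summable_of_summable_weighted_sq {d n : ℕ} (hd : d ≤ 3) {a : (Fin d → ℤ) → ℂ}
    (ha : Summable fun k => (1 + ‖k‖) ^ (2 * (n + 2)) * ‖a k‖ ^ 2) : Summable a := by
  refine .of_norm ?_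
  have hw := summable_one_add_norm_pow_inv (d := d) (r := 4) (by omega)
  have h := (summable_mul_and_tsum_mul_sq_le (f := fun k : Fin d → ℤ => ((1 + ‖k‖) ^ (n + 2))⁻¹)
    (g := fun k => (1 + ‖k‖) ^ (n + 2) * ‖a k‖) (fun k => by positivity) (fun k => by positivity)
    (Summable.of_nonneg_of_le (fun k => by positivity) (fun k => ?_) hw)
    (ha.congr fun k => by ring)).1
  · refine h.congr fun k => ?_
    have : 0 < 1 + ‖k‖ := by positivity
    field_simp
  · rw [inv_pow, ← pow_mul]
    gcongr
    · linarith [norm_nonneg k]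
    · omega

/-- Inside the frequency window the error coefficient is the sum of the aliases `a_{j + N l}` with
`l ≠ 0`; the Cauchy–Schwarz inequality with weights `(1 + |j + N l|)^{n+2}` bounds it by
`N^{-(n+2)}` times a constant and the weighted `ℓ²` norm of the aliases. -/
lemma sq_norm_aliasError_le {d n N : ℕ} (hd : d ≤ 3) (hN : 0 < N) (hN2 : Even N)
    {a : (Fin d → ℤ) → ℂ}
    (ha : Summable fun k => (1 + ‖k‖) ^ (2 * (n + 2)) * ‖a k‖ ^ 2) {j : Fin d → ℤ}
    (hj : j ∈ frequencies d N) :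
    ‖aliasError N a j‖ ^ 2 ≤ ((4 / (N : ℝ)) ^ (2 * (n + 2)) *
      ∑' k : Fin d → ℤ, ((1 + ‖k‖) ^ 4)⁻¹) *
      ∑' l : Fin d → ℤ, (1 + ‖j + (N : ℤ) • l‖) ^ (2 * (n + 2)) * ‖a (j + (N : ℤ) • l)‖ ^ 2 := by
  classical
  have hN' : (0 : ℝ) < N := by exact_mod_cast hN
  have hw := summable_one_add_norm_pow_inv (d := d) (r := 4) (by omega)
  have has := (summable_of_summable_weighted_sq hd ha).comp_injective (alias_injective hN j)
  have hu := ha.comp_injective (alias_injective hN j)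
  simp only [Function.comp_def] at has hu
  -- The term `l = 0` cancels against `a_j`, so the weight `f` is set to `0` there.
  set f : (Fin d → ℤ) → ℝ := fun l => if l = 0 then 0 else ((1 + ‖j + (N : ℤ) • l‖) ^ (n + 2))⁻¹
    with hf
  set g : (Fin d → ℤ) → ℝ := fun l => (1 + ‖j + (N : ℤ) • l‖) ^ (n + 2) * ‖a (j + (N : ℤ) • l)‖
    with hg
  have hf0 : ∀ l, 0 ≤ f l := fun l => by
    simp only [hf]; split_ifs <;> positivity
  have hg0 : ∀ l, 0 ≤ g l := fun l => by simp only [hg]; positivity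
  have hfle : ∀ l, f l ^ 2 ≤ (4 / (N : ℝ)) ^ (2 * (n + 2)) * ((1 + ‖l‖) ^ 4)⁻¹ := fun l => by
    simp only [hf]
    split_ifs with hl
    · rw [zero_pow two_ne_zero]
      positivity
    · have h1 := one_add_norm_alias_ge hN2 hj hl
      have h2 : (0 : ℝ) < N / 4 * (1 + ‖l‖) := by positivity
      have h3 : (1 : ℝ) ≤ 1 + ‖l‖ := by linarith [norm_nonneg l]
      calc (((1 + ‖j + (N : ℤ) • l‖) ^ (n + 2))⁻¹) ^ 2
          = ((1 + ‖j + (N : ℤ) • l‖) ^ (2 * (n + 2)))⁻¹ := by rw [inv_pow, ← pow_mul, mul_comm 2]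
        _ ≤ (((N : ℝ) / 4 * (1 + ‖l‖)) ^ (2 * (n + 2)))⁻¹ := by gcongr
        _ = (4 / (N : ℝ)) ^ (2 * (n + 2)) * ((1 + ‖l‖) ^ (2 * (n + 2)))⁻¹ := by
            rw [mul_pow, mul_inv, ← inv_pow, inv_div]
        _ ≤ _ := by
            gcongr
            omega
  have hf2 : Summable fun l => f l ^ 2 :=
    Summable.of_nonneg_of_le (fun l => sq_nonneg _) hfle (hw.mul_left _)
  have hg2 : Summable fun l => g l ^ 2 := hu.congr fun l => by simp only [hg]; ring
  obtain ⟨hs, hcs⟩ := summable_mul_and_tsum_mul_sq_le hf0 hg0 hf2 hg2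
  have hfg : ∀ l, f l * g l = ‖if l = 0 then 0 else a (j + (N : ℤ) • l)‖ := fun l => by
    simp only [hf, hg]
    split_ifs with hl
    · simp
    · have : 0 < 1 + ‖j + (N : ℤ) • l‖ := by positivity
      field_simp
  have herr : aliasError N a j = -∑' l : Fin d → ℤ, if l = 0 then 0 else a (j + (N : ℤ) • l) := by
    rw [aliasError, if_pos hj, has.tsum_eq_add_tsum_ite 0]
    simp
  have hle : ‖aliasError N a j‖ ≤ ∑' l, f l * g l := by
    rw [herr, norm_neg]
    simp only [hfg] at hs ⊢
    exact norm_tsum_le_tsum_norm hs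
  calc ‖aliasError N a j‖ ^ 2 ≤ (∑' l, f l * g l) ^ 2 := by gcongr
    _ ≤ (∑' l, f l ^ 2) * ∑' l, g l ^ 2 := hcs
    _ ≤ _ := by
      have e1 : ∑' l, g l ^ 2 = ∑' l : Fin d → ℤ,
          (1 + ‖j + (N : ℤ) • l‖) ^ (2 * (n + 2)) * ‖a (j + (N : ℤ) • l)‖ ^ 2 :=
        tsum_congr fun l => by simp only [hg]; ring
      rw [e1, ← tsum_mul_left (a := (4 / (N : ℝ)) ^ (2 * (n + 2)))]
      refine mul_le_mul_of_nonneg_right (hf2.tsum_le_tsum hfle (hw.mul_left _))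
        (tsum_nonneg fun l => by positivity)

/-- The `H²` norm of the interpolation error, on the Fourier side: it decays like `N^{-n}` when the
coefficients have finite `H^{n+2}` norm. -/
lemma exists_tsum_weighted_sq_aliasError_le {d n : ℕ} (hd : d ≤ 3) {a : (Fin d → ℤ) → ℂ}
    (ha : Summable fun k => (1 + ‖k‖) ^ (2 * (n + 2)) * ‖a k‖ ^ 2) :
    ∃ C : ℝ, 0 ≤ C ∧ ∀ N : ℕ, 0 < N → Even N →
      Summable (fun k => (1 + ‖k‖) ^ 4 * ‖aliasError N a k‖ ^ 2) ∧
      ∑' k, (1 + ‖k‖) ^ 4 * ‖aliasError N a k‖ ^ 2 ≤ C * (((N : ℝ) ^ n)⁻¹) ^ 2 := by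
  classical
  set u : (Fin d → ℤ) → ℝ := fun k => (1 + ‖k‖) ^ (2 * (n + 2)) * ‖a k‖ ^ 2 with hu
  have hu0 : ∀ k, 0 ≤ u k := fun k => by positivity
  set K : ℝ := ∑' k : Fin d → ℤ, ((1 + ‖k‖) ^ 4)⁻¹ with hK
  have hK0 : 0 ≤ K := tsum_nonneg fun k => by positivity
  set S : ℝ := ∑' k, u k with hS
  have hS0 : 0 ≤ S := tsum_nonneg hu0
  set C₁ : ℝ := 4 ^ (2 * (n + 2)) * (K + 1) with hC₁
  refine ⟨C₁ * (S + S), by positivity, fun N hN hN2 => ?_⟩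
  have hN' : (0 : ℝ) < N := by exact_mod_cast hN
  have hN'' : (2 : ℝ) ≤ N := by
    obtain ⟨M, rfl⟩ := hN2
    exact_mod_cast (by omega : 2 ≤ M + M)
  set δ : ℝ := (((N : ℝ) ^ n)⁻¹) ^ 2 with hδ
  set B : (Fin d → ℤ) → ℝ := fun k =>
    if k ∈ frequencies d N then ∑' l : Fin d → ℤ, u (k + (N : ℤ) • l) else u k with hB
  have hU0 : ∀ k, 0 ≤ ∑' l : Fin d → ℤ, u (k + (N : ℤ) • l) := fun k => tsum_nonneg fun l => hu0 _
  have hpt : ∀ k, (1 + ‖k‖) ^ 4 * ‖aliasError N a k‖ ^ 2 ≤ C₁ * δ * B k := fun k => by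
    simp only [hB]
    split_ifs with hk
    · -- Inside the window `(1 + |k|)^4 ≤ N^4` uses up four of the `2n + 4` powers of `1/N`.
      have h1 := sq_norm_aliasError_le hd hN hN2 ha hk
      have h2 := norm_le_of_mem_frequencies hN2 hk
      have h3 : 1 + ‖k‖ ≤ N := by linarith
      calc (1 + ‖k‖) ^ 4 * ‖aliasError N a k‖ ^ 2
          ≤ (N : ℝ) ^ 4 * (((4 / (N : ℝ)) ^ (2 * (n + 2)) * K) *
            ∑' l : Fin d → ℤ, u (k + (N : ℤ) • l)) := by gcongr
        _ = 4 ^ (2 * (n + 2)) * K * δ * ∑' l : Fin d → ℤ, u (k + (N : ℤ) • l) := by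
          rw [hδ, div_pow]
          field_simp
          ring
        _ ≤ _ := by
          have := hU0 k
          rw [hC₁]
          gcongr
          linarith
    · -- Outside the window `1 + |k| ≥ N/2`, so `2n` powers of the weight are traded for `N^{-2n}`.
      have h2 := le_norm_of_notMem_frequencies hN2 hk
      have h3 : (N : ℝ) / 2 ≤ 1 + ‖k‖ := by linarith
      have h4 : aliasError N a k = a k := by simp [aliasError, hk]
      have h5 : ((N : ℝ) / 2) ^ (2 * n) ≤ (1 + ‖k‖) ^ (2 * n) := by gcongr
      have h6 : 1 ≤ C₁ * δ * ((N : ℝ) / 2) ^ (2 * n) := by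
        have e : C₁ * δ * ((N : ℝ) / 2) ^ (2 * n) = 2 ^ (2 * n) * 256 * (K + 1) := by
          rw [hC₁, hδ, div_pow, show (4 : ℝ) = 2 * 2 by norm_num, mul_pow]
          field_simp
          ring
        rw [e]
        have e2 : (1 : ℝ) ≤ 2 ^ (2 * n) := one_le_pow₀ (by norm_num)
        nlinarith
      rw [h4]
      calc (1 + ‖k‖) ^ 4 * ‖a k‖ ^ 2 = 1 * ((1 + ‖k‖) ^ 4 * ‖a k‖ ^ 2) := (one_mul _).symm
        _ ≤ (C₁ * δ * (1 + ‖k‖) ^ (2 * n)) * ((1 + ‖k‖) ^ 4 * ‖a k‖ ^ 2) := by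
          gcongr
          exact h6.trans (by gcongr)
        _ = C₁ * δ * u k := by rw [hu]; ring
  -- The pairs (window frequency, shift) index distinct frequencies, so the folded sums add up to
  -- at most the full sum `S`.
  have hF : ∑ k ∈ frequencies d N, ∑' l : Fin d → ℤ, u (k + (N : ℤ) • l) ≤ S := by
    have hinj := frequencies_add_smul_injective (d := d) hN
    have hs := ha.comp_injective hinj
    have h1 := hs.tsum_prod
    simp only [Function.comp_apply] at h1
    rw [← Finset.tsum_subtype (frequencies d N), ← h1]
    exact hs.tsum_le_tsum_of_inj _ hinj (fun c _ => hu0 c) (fun p => le_rfl) ha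
  have hsum : ∀ s : Finset (Fin d → ℤ),
      ∑ k ∈ s, (1 + ‖k‖) ^ 4 * ‖aliasError N a k‖ ^ 2 ≤ C₁ * (S + S) * δ := fun s => by
    calc ∑ k ∈ s, (1 + ‖k‖) ^ 4 * ‖aliasError N a k‖ ^ 2
        ≤ ∑ k ∈ s, C₁ * δ * B k := Finset.sum_le_sum fun k _ => hpt k
      _ = C₁ * δ * ∑ k ∈ s, B k := by rw [Finset.mul_sum]
      _ ≤ C₁ * δ * (S + S) := by
        gcongr
        simp only [hB, Finset.sum_ite]
        refine add_le_add (le_trans ?_ hF) ((Finset.sum_le_sum_of_subset_of_nonneg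
          (Finset.filter_subset _ s) fun k _ _ => hu0 k).trans (ha.sum_le_tsum _ fun k _ => hu0 k))
        exact Finset.sum_le_sum_of_subset_of_nonneg
          (fun k hk => (Finset.mem_filter.1 hk).2) fun k _ _ => hU0 k
      _ = _ := by ring
  exact ⟨summable_of_sum_le (fun k => by positivity) hsum,
    Real.tsum_le_of_sum_le (fun k => by positivity) hsum⟩

/-! ### The interpolation error -/

lemma sum_exp_eq {N : ℕ} (hN : 0 < N) (r : ℤ) :
    ∑ n : Fin N, Complex.exp (Complex.I * ((2 * Real.pi * r * (n : ℕ) / N : ℝ) : ℂ))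
      = if (N : ℤ) ∣ r then (N : ℂ) else 0 := by
  have hN' : (N : ℂ) ≠ 0 := by exact_mod_cast hN.ne'
  set ζ : ℂ := Complex.exp (2 * Real.pi * Complex.I * r / N) with hζ
  have h1 : ∀ n : ℕ, Complex.exp (Complex.I * ((2 * Real.pi * r * n / N : ℝ) : ℂ)) = ζ ^ n := by
    intro n
    rw [hζ, ← Complex.exp_nat_mul]
    congr 1
    push_cast
    ring
  simp only [h1]
  rw [Fin.sum_univ_eq_sum_range (fun n => ζ ^ n)]
  have h2 : ζ ^ N = 1 := by
    rw [hζ, ← Complex.exp_nat_mul, Complex.exp_eq_one_iff]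
    exact ⟨r, by field_simp⟩
  have h3 : ζ = 1 ↔ (N : ℤ) ∣ r := by
    rw [hζ, Complex.exp_eq_one_iff]
    constructor
    · rintro ⟨l, hl⟩
      refine ⟨l, ?_⟩
      have hpi : (2 * Real.pi * Complex.I : ℂ) ≠ 0 := Complex.two_pi_I_ne_zero
      have : (r : ℂ) = N * l := by
        field_simp at hl
        have h4 : (2 * Real.pi * Complex.I : ℂ) * r = (2 * Real.pi * Complex.I) * (N * l) := by
          linear_combination (2 * Real.pi * Complex.I : ℂ) * hl
        exact mul_left_cancel₀ hpi h4
      exact_mod_cast this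
    · rintro ⟨l, rfl⟩
      refine ⟨l, ?_⟩
      push_cast
      field_simp
  split_ifs with hd
  · simp [h3.2 hd]
  · have hne : ζ ≠ 1 := fun h => hd (h3.1 h)
    rw [geom_sum_eq hne, h2, sub_self, zero_div]

/-- Orthogonality of the plane waves on the grid, up to aliasing modulo `N`. -/
lemma sum_planeWave_gridPoint {d N : ℕ} {L : ℝ} (hL : 0 < L) (hN : 0 < N) (k j : Fin d → ℤ) :
    1 / (N : ℂ) ^ d * ∑ n : Fin d → Fin N, planeWave L k (gridPoint L N n)
        * (starRingEnd ℂ) (planeWave L j (gridPoint L N n))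
      = if ∀ i, (N : ℤ) ∣ k i - j i then 1 else 0 := by
  have hN' : (N : ℂ) ≠ 0 := by exact_mod_cast hN.ne'
  have hNr : (N : ℝ) ≠ 0 := by exact_mod_cast hN.ne'
  have h1 : ∀ n : Fin d → Fin N, planeWave L k (gridPoint L N n)
        * (starRingEnd ℂ) (planeWave L j (gridPoint L N n))
      = ∏ i, Complex.exp (Complex.I *
          ((2 * Real.pi * ((k i - j i : ℤ) : ℝ) * ((n i : ℕ) : ℝ) / N : ℝ) : ℂ)) := by
    intro n
    rw [← planeWave_neg, ← planeWave_add, planeWave]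
    refine Finset.prod_congr rfl fun i _ => ?_
    congr 3
    simp only [gridPoint, Pi.add_apply, Pi.neg_apply]
    push_cast
    field_simp
    ring
  simp only [h1]
  have h2 := Finset.prod_univ_sum (fun _ : Fin d => (Finset.univ : Finset (Fin N)))
    (fun i n => Complex.exp (Complex.I *
          ((2 * Real.pi * ((k i - j i : ℤ) : ℝ) * ((n : ℕ) : ℝ) / N : ℝ) : ℂ)))
  rw [Fintype.piFinset_univ] at h2
  rw [← h2]
  simp only [sum_exp_eq hN]
  split_ifs with h
  · rw [Finset.prod_congr rfl fun i _ => if_pos (h i)]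
    simp [hN']
  · push Not at h
    obtain ⟨i, hi⟩ := h
    rw [Finset.prod_eq_zero (Finset.mem_univ i) (if_neg hi), mul_zero]

/-- The **aliasing formula**: the discrete Fourier coefficients of an absolutely convergent Fourier
series are the sums of its coefficients over residue classes modulo `N`. -/
lemma hasSum_alias_discreteCoeff {d N : ℕ} {L : ℝ} (hL : 0 < L) (hN : 0 < N)
    {a : (Fin d → ℤ) → ℂ} {p : (Fin d → ℝ) → ℂ}
    (hp : ∀ x, HasSum (fun k => a k * planeWave L k x) (p x)) (j : Fin d → ℤ) :
    HasSum (fun l : Fin d → ℤ => a (j + (N : ℤ) • l)) (discreteCoeff L N p j) := by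
  have h1 : HasSum (fun k => 1 / (N : ℂ) ^ d * ∑ n : Fin d → Fin N,
      a k * planeWave L k (gridPoint L N n) * (starRingEnd ℂ) (planeWave L j (gridPoint L N n)))
      (discreteCoeff L N p j) :=
    (hasSum_sum fun n _ => (hp (gridPoint L N n)).mul_right _).mul_left _
  have h2 : ∀ k, 1 / (N : ℂ) ^ d * ∑ n : Fin d → Fin N,
      a k * planeWave L k (gridPoint L N n) * (starRingEnd ℂ) (planeWave L j (gridPoint L N n))
      = a k * if ∀ i, (N : ℤ) ∣ k i - j i then 1 else 0 := by
    intro k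
    rw [← sum_planeWave_gridPoint hL hN k j]
    simp only [mul_assoc, ← Finset.mul_sum]
    ring
  simp only [h2] at h1
  have h3 := (alias_injective hN j).hasSum_iff
    (f := fun k => a k * if ∀ i, (N : ℤ) ∣ k i - j i then 1 else 0)
    (a := discreteCoeff L N p j) (fun k hk => by
      rw [if_neg, mul_zero]
      intro h
      choose l hl using h
      refine hk ⟨l, funext fun i => ?_⟩
      have := hl i
      simp only [Pi.add_apply, Pi.smul_apply, smul_eq_mul]
      linarith)
  refine (h3.2 h1).congr_fun fun l => ?_
  simp

lemma coeff_sub_coeff_interpolant {d N : ℕ} {L : ℝ} (hL : 0 < L) (hN : 0 < N)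
    {f p : (Fin d → ℝ) → ℂ}
    (hp : ∀ x, HasSum (fun k => coeff L f k * planeWave L k x) (p x)) (k : Fin d → ℤ) :
    coeff L f k - coeff L (interpolant L N p) k = aliasError N (coeff L f) k := by
  unfold interpolant
  rw [coeff_sum_planeWave hL, aliasError]
  split_ifs
  · rw [(hasSum_alias_discreteCoeff hL hN hp k).tsum_eq]
  · rfl

lemma contDiff_interpolant {d : ℕ} (L : ℝ) (N : ℕ) (p : (Fin d → ℝ) → ℂ) :
    ContDiff ℝ ∞ (interpolant L N p) :=
  ContDiff.sum fun k _ => contDiff_const.mul (contDiff_planeWave L k)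

lemma isPeriodic_interpolant {d : ℕ} {L : ℝ} (hL : 0 < L) (N : ℕ) (p : (Fin d → ℝ) → ℂ) :
    IsPeriodic L (interpolant L N p) := by
  intro i x
  simp only [interpolant, isPeriodic_planeWave hL _ i x]

lemma hasWeakDeriv_weakDeriv {d : ℕ} {L : ℝ} {α : Fin d → ℕ} {f : (Fin d → ℝ) → ℂ}
    (h : ∃ g, HasWeakDeriv L α f g) : HasWeakDeriv L α f (weakDeriv L α f) := by
  rw [weakDeriv, dif_pos h]
  exact h.choose_spec

/-- Membership in `H^m_p` bounds the Fourier coefficients with the weight `(1 + |k|)^{2m}`; the pure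
derivatives `∂_i^m` suffice because `|k|` is the maximum of the `|k_i|`. -/
lemma MemHp.summable_weighted_sq_coeff {d m : ℕ} (hd : 1 ≤ d) {L : ℝ} (hL : 0 < L)
    {f : (Fin d → ℝ) → ℂ} (hf : MemHp L m f) :
    Summable fun k => (1 + ‖k‖) ^ (2 * m) * ‖coeff L f k‖ ^ 2 := by
  have : Nonempty (Fin d) := ⟨⟨0, hd⟩⟩
  have hg : ∀ i : Fin d, ∃ g, HasWeakDeriv L (Pi.single i m) f g := fun i =>
    hf.2.2 _ (by rw [Finset.sum_pi_single', if_pos (Finset.mem_univ i)])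
  choose g hg using hg
  have h1 : Summable fun k => (4 : ℝ) ^ m * (‖coeff L f k‖ ^ 2
      + ∑ i, (L / Real.pi) ^ (2 * m) * ‖coeff L (g i) k‖ ^ 2) :=
    ((hasSum_sq_coeff hL hf.2.1).summable.add (summable_sum fun i _ =>
      (hasSum_sq_coeff hL (hg i).1).summable.mul_left _)).mul_left _
  refine Summable.of_nonneg_of_le (fun k => by positivity) (fun k => ?_) h1
  have h2 : ∀ i, (L / Real.pi) ^ (2 * m) * ‖coeff L (g i) k‖ ^ 2
      = ‖k i‖ ^ (2 * m) * ‖coeff L f k‖ ^ 2 := fun i => by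
    rw [(hg i).coeff_eq hL k, norm_mul, norm_pow, norm_symbol hL, Int.norm_eq_abs]
    have := Real.pi_pos
    simp only [mul_pow, div_pow, ← pow_mul, mul_comm m 2]
    field_simp
  simp only [h2]
  obtain ⟨i, hi⟩ := Finite.exists_max fun i => ‖k i‖
  have h3 : ‖k‖ = ‖k i‖ :=
    le_antisymm ((pi_norm_le_iff_of_nonneg (norm_nonneg _)).2 hi) (norm_le_pi_norm k i)
  have h4 : ‖k i‖ ^ (2 * m) * ‖coeff L f k‖ ^ 2 ≤ ∑ i, ‖k i‖ ^ (2 * m) * ‖coeff L f k‖ ^ 2 :=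
    Finset.single_le_sum (f := fun i => ‖k i‖ ^ (2 * m) * ‖coeff L f k‖ ^ 2)
      (fun j _ => by positivity) (Finset.mem_univ i)
  have h5 : (1 + ‖k‖) ^ (2 * m) ≤ 4 ^ m * (1 + ‖k‖ ^ (2 * m)) := by
    have h0 := norm_nonneg k
    rw [show (4 : ℝ) = 2 ^ 2 by norm_num, ← pow_mul]
    rcases le_total ‖k‖ 1 with h | h
    · calc (1 + ‖k‖) ^ (2 * m) ≤ 2 ^ (2 * m) := by gcongr; linarith
        _ = 2 ^ (2 * m) * 1 := (mul_one _).symm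
        _ ≤ _ := by gcongr; linarith [pow_nonneg h0 (2 * m)]
    · calc (1 + ‖k‖) ^ (2 * m) ≤ (2 * ‖k‖) ^ (2 * m) := by gcongr; linarith
        _ = 2 ^ (2 * m) * ‖k‖ ^ (2 * m) := mul_pow _ _ _
        _ ≤ _ := by gcongr; linarith
  calc (1 + ‖k‖) ^ (2 * m) * ‖coeff L f k‖ ^ 2
      ≤ (4 ^ m * (1 + ‖k‖ ^ (2 * m))) * ‖coeff L f k‖ ^ 2 := by gcongr
    _ = 4 ^ m * (‖coeff L f k‖ ^ 2 + ‖k i‖ ^ (2 * m) * ‖coeff L f k‖ ^ 2) := by rw [h3]; ring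
    _ ≤ _ := by gcongr

/-- The interpolation error of an `H^{n+2}` function in dimension at most three: its supremum norm
and the `L²` norms of its pure second derivatives are `O(N^{-n})`. -/
lemma MemHp.exists_interpolation_error_le {d n : ℕ} (hd : 1 ≤ d) (hd₃ : d ≤ 3) {L : ℝ}
    (hL : 0 < L) {f : (Fin d → ℝ) → ℂ} (hf : MemHp L (n + 2) f) :
    ∃ p, IsContinuousRep L f p ∧ ∃ C : ℝ, 0 ≤ C ∧ ∀ N : ℕ, 0 < N → Even N →
      (∀ᵐ x ∂(boxMeasure d L), ‖f x - interpolant L N p x‖ ≤ C * ((N : ℝ) ^ n)⁻¹) ∧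
      ∀ i : Fin d, MemLp (fun x => weakDeriv L (Pi.single i 2) f x
          - weakDeriv L (Pi.single i 2) (interpolant L N p) x) 2 (boxMeasure d L) ∧
        eLpNorm (fun x => weakDeriv L (Pi.single i 2) f x
          - weakDeriv L (Pi.single i 2) (interpolant L N p) x) 2 (boxMeasure d L)
          ≤ ENNReal.ofReal (C * ((N : ℝ) ^ n)⁻¹) := by
  have ha := hf.summable_weighted_sq_coeff hd hL
  have hsum := summable_of_summable_weighted_sq hd₃ ha
  obtain ⟨p, hp, hps⟩ := exists_isContinuousRep_of_summable_coeff hL hf.2.1 hsum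
  obtain ⟨C, hC, hbound⟩ := exists_tsum_weighted_sq_aliasError_le hd₃ ha
  have hw := summable_one_add_norm_pow_inv (d := d) (r := 4) (by omega)
  set K : ℝ := ∑' k : Fin d → ℤ, ((1 + ‖k‖) ^ 4)⁻¹ with hK
  have hK0 : 0 ≤ K := tsum_nonneg fun k => by positivity
  have hwt := boxWeight_pos hL d
  set C₁ : ℝ := Real.sqrt (K * C) with hC₁
  set C₂ : ℝ := (Real.sqrt (boxWeight d L))⁻¹ * ((Real.pi / L) ^ 2 * Real.sqrt C) with hC₂
  have hC₁0 : 0 ≤ C₁ := Real.sqrt_nonneg _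
  have hC₂0 : 0 ≤ C₂ := by positivity
  refine ⟨p, hp, C₁ + C₂, by positivity, fun N hN hN2 => ?_⟩
  obtain ⟨hes, hele⟩ := hbound N hN hN2
  set e := aliasError N (coeff L f) with he
  have hδ : 0 ≤ ((N : ℝ) ^ n)⁻¹ := by positivity
  have herr : ∀ k, coeff L f k - coeff L (interpolant L N p) k = e k :=
    coeff_sub_coeff_interpolant hL hN hps
  refine ⟨?_, fun i => ?_⟩
  · -- The error is bounded by the sum of its Fourier coefficients, which the Cauchy–Schwarz
    -- inequality compares with the `H²` norm since `∑ (1 + |k|)^{-4}` converges for `d ≤ 3`.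
    obtain ⟨hs1, hcs⟩ := summable_mul_and_tsum_mul_sq_le
      (f := fun k : Fin d → ℤ => ((1 + ‖k‖) ^ 2)⁻¹) (g := fun k => (1 + ‖k‖) ^ 2 * ‖e k‖)
      (fun k => by positivity) (fun k => by positivity)
      (hw.congr fun k => by rw [inv_pow, ← pow_mul]) (hes.congr fun k => by ring)
    have h1 : ∀ k : Fin d → ℤ, ((1 + ‖k‖) ^ 2)⁻¹ * ((1 + ‖k‖) ^ 2 * ‖e k‖) = ‖e k‖ := fun k => by
      have : 0 < 1 + ‖k‖ := by positivity
      field_simp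
    have h2 : ∀ k : Fin d → ℤ, (((1 + ‖k‖) ^ 2)⁻¹) ^ 2 = ((1 + ‖k‖) ^ 4)⁻¹ := fun k => by
      rw [inv_pow, ← pow_mul]
    have h3 : ∀ k, ((1 + ‖k‖) ^ 2 * ‖e k‖) ^ 2 = (1 + ‖k‖) ^ 4 * ‖e k‖ ^ 2 := fun k => by ring
    simp only [h1, h2, h3] at hs1 hcs
    have h4 : ∑' k, ‖e k‖ ≤ C₁ * ((N : ℝ) ^ n)⁻¹ := by
      have h5 : (∑' k, ‖e k‖) ^ 2 ≤ (C₁ * ((N : ℝ) ^ n)⁻¹) ^ 2 := by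
        rw [mul_pow, hC₁, Real.sq_sqrt (by positivity), mul_assoc]
        exact hcs.trans (by gcongr)
      exact le_of_sq_le_sq h5 (by positivity)
    filter_upwards [hp.2.2] with x hx
    have h6 : HasSum (fun k => e k * planeWave L k x) (p x - interpolant L N p x) := by
      have h7 : HasSum (fun k => coeff L (interpolant L N p) k * planeWave L k x)
          (interpolant L N p x) := by
        have h8 : ∀ k ∉ frequencies d N,
            coeff L (interpolant L N p) k * planeWave L k x = 0 := fun k hk => by
          unfold interpolant
          rw [coeff_sum_planeWave hL, if_neg hk, zero_mul]
        have h9 := hasSum_sum_of_ne_finset_zero (L := .unconditional _) h8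
        convert h9 using 1
        unfold interpolant
        refine Finset.sum_congr rfl fun k hk => ?_
        rw [coeff_sum_planeWave hL, if_pos hk]
      refine ((hps x).sub h7).congr_fun fun k => ?_
      rw [← herr k, sub_mul]
    rw [← hx, ← h6.tsum_eq]
    calc ‖∑' k, e k * planeWave L k x‖ ≤ ∑' k, ‖e k‖ :=
          tsum_of_norm_bounded hs1.hasSum fun k => by rw [norm_mul, norm_planeWave, mul_one]
      _ ≤ C₁ * ((N : ℝ) ^ n)⁻¹ := h4
      _ ≤ _ := by gcongr; linarith
  · have hwf := hasWeakDeriv_weakDeriv (hf.2.2 (Pi.single i 2)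
      (by rw [Finset.sum_pi_single', if_pos (Finset.mem_univ i)]; omega))
    have hwi := hasWeakDeriv_weakDeriv ⟨_, hasWeakDeriv_of_contDiff hL i 2
      (contDiff_interpolant L N p) (isPeriodic_interpolant hL N p)⟩
    have hmem := hwf.1.sub hwi.1
    refine ⟨hmem, ?_⟩
    have h1 : ∀ k, ‖coeff L (fun x => weakDeriv L (Pi.single i 2) f x
          - weakDeriv L (Pi.single i 2) (interpolant L N p) x) k‖ ^ 2
        ≤ (Real.pi / L) ^ 4 * ((1 + ‖k‖) ^ 4 * ‖e k‖ ^ 2) := fun k => by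
      rw [coeff_sub hL hwf.1 hwi.1, hwf.coeff_eq hL, hwi.coeff_eq hL, ← mul_sub, herr k, norm_mul,
        norm_pow, norm_symbol hL, ← Int.norm_eq_abs]
      have h2 : ‖k i‖ ≤ 1 + ‖k‖ := by linarith [norm_le_pi_norm k i]
      calc ((Real.pi / L * ‖k i‖) ^ 2 * ‖e k‖) ^ 2
          = (Real.pi / L) ^ 4 * (‖k i‖ ^ 4 * ‖e k‖ ^ 2) := by ring
        _ ≤ _ := by gcongr
    refine (eLpNorm_le_of_tsum_sq_coeff_le hL hmem
      (B := (Real.pi / L) ^ 2 * Real.sqrt C * ((N : ℝ) ^ n)⁻¹) (by positivity) ?_).trans ?_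
    · calc _ ≤ ∑' k, (Real.pi / L) ^ 4 * ((1 + ‖k‖) ^ 4 * ‖e k‖ ^ 2) :=
            (hasSum_sq_coeff hL hmem).summable.tsum_le_tsum h1 (hes.mul_left _)
        _ = (Real.pi / L) ^ 4 * ∑' k, (1 + ‖k‖) ^ 4 * ‖e k‖ ^ 2 := tsum_mul_left
        _ ≤ (Real.pi / L) ^ 4 * (C * (((N : ℝ) ^ n)⁻¹) ^ 2) := by gcongr
        _ = _ := by
          rw [mul_pow, mul_pow, Real.sq_sqrt hC]
          ring
    · refine ENNReal.ofReal_le_ofReal ?_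
      rw [← mul_assoc, ← hC₂]
      gcongr
      linarith

/-! ### Multiplication by rough coefficients and the operator estimate -/

lemma MemLp.mul_of_four {d : ℕ} {L : ℝ} {f g : (Fin d → ℝ) → ℂ}
    (hf : MemLp f 4 (boxMeasure d L)) (hg : MemLp g 4 (boxMeasure d L)) :
    MemLp (fun x => f x * g x) 2 (boxMeasure d L) := by
  have : ENNReal.HolderTriple 4 4 2 := ⟨by
    rw [← two_mul, show (4 : ℝ≥0∞) = 2 * 2 by norm_num, ENNReal.mul_inv (by simp) (by simp),
      ← mul_assoc, ENNReal.mul_inv_cancel (by simp) (by simp), one_mul]⟩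
  exact hg.mul hf

/-- Multiplication by a square integrable coefficient is bounded from `L^∞` to `L²`; hence no
smoothness of the potential and of the linearisation state is needed. -/
lemma eLpNorm_mul_add_mul_le {α : Type*} [MeasurableSpace α] {μ : Measure α} {v w e₀ e₁ : α → ℂ}
    (hv : MemLp v 2 μ) (hw : MemLp w 2 μ) (he₀ : AEStronglyMeasurable e₀ μ)
    (he₁ : AEStronglyMeasurable e₁ μ) {ε : ℝ} (h₀ : ∀ᵐ x ∂μ, ‖e₀ x‖ ≤ ε)
    (h₁ : ∀ᵐ x ∂μ, ‖e₁ x‖ ≤ ε) (hε : 0 ≤ ε) :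
    eLpNorm (fun x => v x * e₀ x + w x * e₁ x) 2 μ
      ≤ ENNReal.ofReal (((eLpNorm v 2 μ).toReal + (eLpNorm w 2 μ).toReal) * ε) := by
  have key : ∀ {u e : α → ℂ}, MemLp u 2 μ → (∀ᵐ x ∂μ, ‖e x‖ ≤ ε) →
      eLpNorm (fun x => u x * e x) 2 μ ≤ ENNReal.ofReal ((eLpNorm u 2 μ).toReal * ε) := by
    intro u e hu he
    rw [mul_comm, ENNReal.ofReal_mul hε, ENNReal.ofReal_toReal hu.2.ne]
    refine eLpNorm_le_mul_eLpNorm_of_ae_le_mul ?_ 2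
    filter_upwards [he] with x hx
    rw [norm_mul, mul_comm]
    gcongr
  rw [add_mul, ENNReal.ofReal_add (by positivity) (by positivity)]
  refine (eLpNorm_add_le (hv.1.mul he₀) (hw.1.mul he₁) (by norm_num)).trans ?_
  exact add_le_add (key hv h₀) (key hw h₁)

lemma eLpNorm_half_sum_add_le {α ι : Type*} [Fintype ι] [MeasurableSpace α] {μ : Measure α}
    {D : ι → α → ℂ} {g : α → ℂ} (hD : ∀ i, MemLp (D i) 2 μ) (hg : AEStronglyMeasurable g μ)
    {ε B : ℝ} (hε : 0 ≤ ε) (hB : 0 ≤ B) (h : ∀ i, eLpNorm (D i) 2 μ ≤ ENNReal.ofReal ε)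
    (hgB : eLpNorm g 2 μ ≤ ENNReal.ofReal B) :
    eLpNorm (fun x => -(1 / 2) * ∑ i, D i x + g x) 2 μ
      ≤ ENNReal.ofReal (Fintype.card ι * ε + B) := by
  have hs : MemLp (fun x => ∑ i, D i x) 2 μ := memLp_finsetSum _ fun i _ => hD i
  have h1 : eLpNorm (fun x => ∑ i, D i x) 2 μ ≤ ENNReal.ofReal (Fintype.card ι * ε) := by
    have h2 := eLpNorm_sum_le (s := Finset.univ) (fun i _ => (hD i).1) (p := 2) (by norm_num)
    have h3 : (∑ i, D i) = fun x => ∑ i, D i x := by ext x; simp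
    rw [h3] at h2
    refine h2.trans ((Finset.sum_le_sum fun i _ => h i).trans ?_)
    simp [ENNReal.ofReal_mul]
  have h4 : eLpNorm (fun x => -(1 / 2) * ∑ i, D i x) 2 μ ≤ ENNReal.ofReal (Fintype.card ι * ε) := by
    refine (eLpNorm_mono fun x => ?_).trans h1
    rw [norm_mul]
    have : ‖(-(1 / 2) : ℂ)‖ ≤ 1 := by norm_num
    exact mul_le_of_le_one_left (norm_nonneg _) this
  rw [ENNReal.ofReal_add (by positivity) hB]
  exact (eLpNorm_add_le (hs.1.const_mul _) hg (by norm_num)).trans (add_le_add h4 hgB)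

lemma vecNorm_le {d : ℕ} {L : ℝ} {f : Fin 2 → (Fin d → ℝ) → ℂ} {B : ℝ}
    (h : ∀ j, eLpNorm (f j) 2 (boxMeasure d L) ≤ ENNReal.ofReal B) :
    vecNorm L f ≤ ENNReal.ofReal (2 * B) := by
  have h1 : ∑ j, eLpNorm (f j) 2 (boxMeasure d L) ^ 2 ≤ ENNReal.ofReal (2 * B) ^ (2 : ℝ) := by
    rw [ENNReal.ofReal_mul (by norm_num), Fin.sum_univ_two, ENNReal.rpow_ofNat, mul_pow]
    calc _ ≤ ENNReal.ofReal B ^ 2 + ENNReal.ofReal B ^ 2 := by gcongr <;> exact h _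
      _ = 2 * ENNReal.ofReal B ^ 2 := (two_mul _).symm
      _ ≤ _ := by
        gcongr
        rw [ENNReal.ofReal_ofNat]
        exact_mod_cast (by norm_num : 2 ≤ 2 ^ 2)
  rw [vecNorm]
  calc _ ≤ (ENNReal.ofReal (2 * B) ^ (2 : ℝ)) ^ (1 / 2 : ℝ) := by gcongr
    _ = _ := by rw [← ENNReal.rpow_mul]; norm_num

lemma memLp_ofReal_potential {d : ℕ} {L : ℝ} {V : (Fin d → ℝ) → ℝ} {φ ψ : (Fin d → ℝ) → ℂ}
    (hV : MemLp V 2 (boxMeasure d L)) (hφ : MemLp φ 4 (boxMeasure d L))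
    (hψ : MemLp ψ 4 (boxMeasure d L)) (a b c e : ℝ) :
    MemLp (fun x => ((V x + a + b * ‖φ x‖ ^ 2 + c * ‖ψ x‖ ^ 2 - e : ℝ) : ℂ)) 2
      (boxMeasure d L) := by
  have hsq : ∀ {χ : (Fin d → ℝ) → ℂ}, MemLp χ 4 (boxMeasure d L) →
      MemLp (fun x => ‖χ x‖ ^ 2) 2 (boxMeasure d L) := fun {χ} hχ => by
    refine (MemLp.mul_of_four hχ hχ).norm.congr_norm (hχ.1.norm.pow 2)
      (Filter.Eventually.of_forall fun x => ?_)
    simp [sq]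
  exact ((((hV.add (memLp_const a)).add ((hsq hφ).const_mul b)).add
    ((hsq hψ).const_mul c)).sub (memLp_const e)).ofReal

end BdG

open BdG in
theorem mainTheorem7 (d : ℕ) (hd₁ : 1 ≤ d) (hd₃ : d ≤ 3) (L : ℝ) (hL : 0 < L)
    (P : BdG.Data d)
    (hV : MemLp P.V 2 (BdG.boxMeasure d L))
    (hφ : ∀ j, MemLp (P.φ j) 4 (BdG.boxMeasure d L))
    (m : ℕ) (hm : (d : ℝ) / 2 + 2 < (m : ℝ))
    (q : Fin 2 → (Fin d → ℝ) → ℂ) (hq : ∀ j, BdG.MemHp L m (q j)) :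
    ∃ p : Fin 2 → (Fin d → ℝ) → ℂ, (∀ j, BdG.IsContinuousRep L (q j) (p j)) ∧
      ∃ c : ℝ, 0 < c ∧ ∀ N : ℕ, 0 < N → Even N →
        BdG.vecNorm L (BdG.opA L P q - BdG.opA L P (fun j => BdG.interpolant L N (p j)))
            ≤ ENNReal.ofReal (c * (N : ℝ) ^ (-((m : ℝ) - 2))) ∧
        BdG.vecNorm L (BdG.opB P q - BdG.opB P (fun j => BdG.interpolant L N (p j)))
            ≤ ENNReal.ofReal (c * (N : ℝ) ^ (-((m : ℝ) - 2))) := by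
  obtain ⟨n, rfl⟩ : ∃ n, m = n + 2 := by
    have h1 : (2 : ℝ) < m := by
      have : (0 : ℝ) ≤ d := Nat.cast_nonneg d
      linarith
    have h2 : 2 < m := by exact_mod_cast h1
    exact ⟨m - 2, by omega⟩
  choose p hp C hC hbound using fun j => (hq j).exists_interpolation_error_le hd₁ hd₃ hL
  set μ := boxMeasure d L with hμ
  have hφc : ∀ j, MemLp (fun x => (starRingEnd ℂ) (P.φ j x)) 4 μ := fun j => (hφ j).star
  -- `A` and `B` are the matrices of zeroth order coefficients of `𝒜` and `ℬ`.
  set A : Fin 2 → Fin 2 → (Fin d → ℝ) → ℂ := ![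
    ![fun x => ((P.V x + P.δ / 2 + 2 * P.β 0 0 * ‖P.φ 0 x‖ ^ 2 + P.β 0 1 * ‖P.φ 1 x‖ ^ 2
        - P.μ 0 : ℝ) : ℂ),
      fun x => P.β 0 1 * P.φ 0 x * (starRingEnd ℂ) (P.φ 1 x) + P.Ω / 2],
    ![fun x => P.β 1 0 * (starRingEnd ℂ) (P.φ 0 x) * P.φ 1 x + P.Ω / 2,
      fun x => ((P.V x - P.δ / 2 + P.β 1 0 * ‖P.φ 0 x‖ ^ 2 + 2 * P.β 1 1 * ‖P.φ 1 x‖ ^ 2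
        - P.μ 1 : ℝ) : ℂ)]] with hA
  set B : Fin 2 → Fin 2 → (Fin d → ℝ) → ℂ := ![
    ![fun x => P.β 0 0 * P.φ 0 x ^ 2, fun x => P.β 0 1 * P.φ 0 x * P.φ 1 x],
    ![fun x => P.β 1 0 * P.φ 0 x * P.φ 1 x, fun x => P.β 1 1 * P.φ 1 x ^ 2]] with hB
  have hcm : ∀ (b : ℂ) {f g : (Fin d → ℝ) → ℂ}, MemLp f 4 μ → MemLp g 4 μ →
      MemLp (fun x => b * f x * g x) 2 μ := fun b f g hf hg => by
    simpa only [mul_assoc] using (MemLp.mul_of_four hf hg).const_mul b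
  have hAm : ∀ j l, MemLp (A j l) 2 μ := by
    intro j l
    fin_cases j <;> fin_cases l
    · exact memLp_ofReal_potential hV (hφ 0) (hφ 1) _ _ _ _
    · exact (hcm _ (hφ 0) (hφc 1)).add (memLp_const _)
    · exact (hcm _ (hφc 0) (hφ 1)).add (memLp_const _)
    · simpa only [sub_eq_add_neg, neg_div] using!
        memLp_ofReal_potential hV (hφ 0) (hφ 1) (-(P.δ / 2)) (P.β 1 0) (2 * P.β 1 1) (P.μ 1)
  have hBm : ∀ j l, MemLp (B j l) 2 μ := by
    intro j l
    fin_cases j <;> fin_cases l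
    · have h := hcm (P.β 0 0) (hφ 0) (hφ 0)
      simp only [mul_assoc, ← sq] at h
      exact h
    · exact hcm _ (hφ 0) (hφ 1)
    · exact hcm _ (hφ 0) (hφ 1)
    · have h := hcm (P.β 1 1) (hφ 1) (hφ 1)
      simp only [mul_assoc, ← sq] at h
      exact h
  set a : Fin 2 → ℝ := fun j => (eLpNorm (A j 0) 2 μ).toReal + (eLpNorm (A j 1) 2 μ).toReal
  set b : Fin 2 → ℝ := fun j => (eLpNorm (B j 0) 2 μ).toReal + (eLpNorm (B j 1) 2 μ).toReal
  have ha0 : ∀ j, 0 ≤ a j := fun j => by positivity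
  have hb0 : ∀ j, 0 ≤ b j := fun j => by positivity
  set C' : ℝ := C 0 + C 1
  have hC' : 0 ≤ C' := add_nonneg (hC 0) (hC 1)
  have hCle : ∀ j, C j ≤ C' := fun j => by
    fin_cases j
    · exact le_add_of_nonneg_right (hC 1)
    · exact le_add_of_nonneg_left (hC 0)
  set c : ℝ := (d + (a 0 + a 1) + (b 0 + b 1)) * C' with hc
  have hc0 : 0 ≤ c := by
    have := ha0 0; have := ha0 1; have := hb0 0; have := hb0 1
    positivity
  -- The summand `1` only serves to make the constant positive.
  refine ⟨p, hp, 2 * c + 1, by linarith, fun N hN hN2 => ?_⟩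
  have hrpow : (N : ℝ) ^ (-(((n + 2 : ℕ) : ℝ) - 2)) = ((N : ℝ) ^ n)⁻¹ := by
    rw [Real.rpow_neg (by positivity)]
    push_cast
    rw [add_sub_cancel_right, Real.rpow_natCast]
  rw [hrpow]
  set η : ℝ := ((N : ℝ) ^ n)⁻¹
  have hη : 0 ≤ η := by positivity
  set E : Fin 2 → (Fin d → ℝ) → ℂ := fun j x => q j x - interpolant L N (p j) x with hE
  set D : Fin 2 → Fin d → (Fin d → ℝ) → ℂ := fun j i x => weakDeriv L (Pi.single i 2) (q j) x
    - weakDeriv L (Pi.single i 2) (interpolant L N (p j)) x with hD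
  have hEm : ∀ j, AEStronglyMeasurable (E j) μ := fun j =>
    (hq j).2.1.1.sub (contDiff_interpolant L N (p j)).continuous.aestronglyMeasurable
  have hEb : ∀ j, ∀ᵐ x ∂μ, ‖E j x‖ ≤ C' * η := fun j => by
    filter_upwards [(hbound j N hN hN2).1] with x hx
    exact hx.trans (mul_le_mul_of_nonneg_right (hCle j) hη)
  have hDm : ∀ j i, MemLp (D j i) 2 μ := fun j i => ((hbound j N hN hN2).2 i).1
  have hDb : ∀ j i, eLpNorm (D j i) 2 μ ≤ ENNReal.ofReal (C' * η) := fun j i =>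
    ((hbound j N hN hN2).2 i).2.trans
      (ENNReal.ofReal_le_ofReal (mul_le_mul_of_nonneg_right (hCle j) hη))
  have hCη : 0 ≤ C' * η := mul_nonneg hC' hη
  have hend : ENNReal.ofReal (2 * (c * η)) ≤ ENNReal.ofReal ((2 * c + 1) * η) :=
    ENNReal.ofReal_le_ofReal (by nlinarith)
  have hA_le : ∀ j, d * (C' * η) + a j * (C' * η) ≤ c * η := fun j => by
    have h1 : a j ≤ a 0 + a 1 := by
      fin_cases j
      · exact le_add_of_nonneg_right (ha0 1)
      · exact le_add_of_nonneg_left (ha0 0)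
    have := hb0 0; have := hb0 1
    calc d * (C' * η) + a j * (C' * η) = (d + a j) * (C' * η) := by ring
      _ ≤ (d + (a 0 + a 1) + (b 0 + b 1)) * (C' * η) :=
        mul_le_mul_of_nonneg_right (by linarith) hCη
      _ = c * η := by rw [hc]; ring
  have hB_le : ∀ j, b j * (C' * η) ≤ c * η := fun j => by
    have h1 : b j ≤ b 0 + b 1 := by
      fin_cases j
      · exact le_add_of_nonneg_right (hb0 1)
      · exact le_add_of_nonneg_left (hb0 0)
    have := ha0 0; have := ha0 1
    calc b j * (C' * η) ≤ (d + (a 0 + a 1) + (b 0 + b 1)) * (C' * η) := by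
          gcongr
          have : (0 : ℝ) ≤ d := Nat.cast_nonneg d
          linarith
      _ = c * η := by rw [hc]; ring
  have hAdiff : ∀ j, (opA L P q - opA L P fun j => interpolant L N (p j)) j
      = fun x => -(1 / 2) * ∑ i, D j i x + (A j 0 x * E 0 x + A j 1 x * E 1 x) := by
    intro j
    funext x
    simp only [hD, Finset.sum_sub_distrib]
    fin_cases j
    · simp [opA, opL₁, laplacian, hA, hE]
      ring
    · simp [opA, opL₂, laplacian, hA, hE]
      ring
  have hBdiff : ∀ j, (opB P q - opB P fun j => interpolant L N (p j)) j
      = fun x => B j 0 x * E 0 x + B j 1 x * E 1 x := by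
    intro j
    funext x
    fin_cases j
    · simp [opB, hB, hE]
      ring
    · simp [opB, hB, hE]
      ring
  constructor
  · refine (vecNorm_le fun j => ?_).trans hend
    rw [hAdiff j]
    have h1 := eLpNorm_mul_add_mul_le (hAm j 0) (hAm j 1) (hEm 0) (hEm 1) (hEb 0) (hEb 1) hCη
    have h2 := eLpNorm_half_sum_add_le (hDm j)
      (((hAm j 0).1.mul (hEm 0)).add ((hAm j 1).1.mul (hEm 1))) hCη
      (mul_nonneg (ha0 j) hCη) (hDb j) h1
    rw [Fintype.card_fin] at h2
    exact h2.trans (ENNReal.ofReal_le_ofReal (hA_le j))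
  · refine (vecNorm_le fun j => ?_).trans hend
    rw [hBdiff j]
    exact (eLpNorm_mul_add_mul_le (hBm j 0) (hBm j 1) (hEm 0) (hEm 1) (hEb 0) (hEb 1) hCη).trans
      (ENNReal.ofReal_le_ofReal (hB_le j))
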